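/- Let $S^6\subset\mathbb R^7$ be the unit sphere, $g$ its round metric (induced by the Euclidean inner product) and $\nabla$ the Levi-Civita connection of $g$. Let $A$ be a $g$-orthogonal complex structure on $S^6$, i.e. a smooth field of endomorphisms of $TS^6$ with $A^2=-\mathrm{Id}$ and $g(AX,AY)=g(X,Y)$ whose Nijenhuis tensor $$N_A(X,Y)=[AX,AY]-A\big([AX,Y]+[X,AY]\big)-[X,Y]$$ vanishes for all smooth vector fields $X,Y$. (Such an $A$ is hypothetical.) Let $\Omega_A(X,Y)=g(AX,Y)$ be its fundamental $2$-form, $(\nabla_XA)Y=\nabla_X(AY)-A(\nabla_XY)$, and let $$(d^\nabla A)(X,Y)=\nabla_X(AY)-\nabla_Y(AX)-A[X,Y]=(\nabla_XA)Y-(\nabla_YA)X .$$ For $TS^6$-valued forms $\alpha$ of degree $k$ and $\beta$ of degree $l$ put $$(\alpha\wedge_g\beta)(X_1,\dots,X_{k+l})=\frac1{k!\,l!}\sum_{\sigma\in S_{k+l}}\operatorname{sign}(\sigma)\,g\big(\alpha(X_{\sigma(1)},\dots,X_{\sigma(k)}),\beta(X_{\sigma(k+1)},\dots,X_{\sigma(k+l)})\big),$$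 and define $\wedge$ of real-valued forms by the same formula with the product of real numbers in place of $g$. Then $$d^\nabla A\wedge_g d^\nabla A+2\,\Omega_A\wedge\Omega_A=0 .$$ Moreover, for all smooth vector fields $X,Y,Z$ on $S^6$: 1. $\|(\nabla_XA)Y\|_g^2=g\big((\nabla_XA)X,(\nabla_YA)Y\big)-\tfrac12\big(\Omega_A(X,Y)^2-\|X\|_g^2\|Y\|_g^2+g(X,Y)^2\big)$; 2. $g\big(d^\nabla A(X,Y),(\nabla_ZA)Z\big)=0$; 3. $\Omega_A\big((\nabla_XA)X,(\nabla_YA)Y\big)=0$. In particular, $\|(\nabla_XA)Y\|_g=\|(\nabla_YA)X\|_g$ for all smooth vector fields $X,Y$. -/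

import Mathlib

open scoped Manifold ContDiff Bundle InnerProductSpace Nat

noncomputable section

section AlmostComplex

variable {E : Type*} [NormedAddCommGroup E] [NormedSpace ℝ E]
  {H : Type*} [TopologicalSpace H] {I : ModelWithCorners ℝ E H}
  {M : Type*} [TopologicalSpace M] [ChartedSpace H M]

/-- The vector field `X` on `M` is smooth. -/
def IsSmoothVectorField [IsManifold I ∞ M] (X : ∀ x : M, TangentSpace I x) : Prop :=
  ContMDiff I I.tangent ∞ (fun x => (⟨x, X x⟩ : TangentBundle I M))

/-- The vector field `A Y`, for a field of endomorphisms `A`. -/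
def applyEnd (A : ∀ x : M, TangentSpace I x →L[ℝ] TangentSpace I x)
    (Y : ∀ x : M, TangentSpace I x) : ∀ x : M, TangentSpace I x :=
  fun x => A x (Y x)

/-- `A` is a smooth field of endomorphisms of the tangent bundle with `A² = -1`. -/
structure IsAlmostComplexStructure [IsManifold I ∞ M]
    (A : ∀ x : M, TangentSpace I x →L[ℝ] TangentSpace I x) : Prop where
  smooth : ContMDiff I (I.prod 𝓘(ℝ, E →L[ℝ] E)) ∞
    (fun x => Bundle.TotalSpace.mk' (E →L[ℝ] E)
      (E := fun x : M => TangentSpace I x →L[ℝ] TangentSpace I x) x (A x))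
  apply_apply : ∀ (x : M) (v : TangentSpace I x), A x (A x v) = -v

/-- The Nijenhuis tensor `[AX, AY] - A([AX, Y] + [X, AY]) - [X, Y]`. -/
def nijenhuis (A : ∀ x : M, TangentSpace I x →L[ℝ] TangentSpace I x)
    (X Y : ∀ x : M, TangentSpace I x) (x : M) : TangentSpace I x :=
  VectorField.mlieBracket I (applyEnd A X) (applyEnd A Y) x
    - A x (VectorField.mlieBracket I (applyEnd A X) Y x
        + VectorField.mlieBracket I X (applyEnd A Y) x)
    - VectorField.mlieBracket I X Y x

/-- `A` is integrable: its Nijenhuis tensor vanishes on all smooth vector fields. -/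
def IsIntegrable [IsManifold I ∞ M]
    (A : ∀ x : M, TangentSpace I x →L[ℝ] TangentSpace I x) : Prop :=
  ∀ X Y : ∀ x : M, TangentSpace I x, IsSmoothVectorField X → IsSmoothVectorField Y →
    ∀ x, nijenhuis A X Y x = 0

/-- `A` is orthogonal with respect to the metric `g`. -/
def IsOrthogonalFor (g : ∀ x : M, LinearMap.BilinForm ℝ (TangentSpace I x))
    (A : ∀ x : M, TangentSpace I x →L[ℝ] TangentSpace I x) : Prop :=
  ∀ (x : M) (u v : TangentSpace I x), g x (A x u) (A x v) = g x u v

/-- The norm of a tangent vector with respect to the metric `g`. -/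
def metricNorm (g : ∀ x : M, LinearMap.BilinForm ℝ (TangentSpace I x))
    (x : M) (v : TangentSpace I x) : ℝ :=
  Real.sqrt (g x v v)

/-- The fundamental form `Ω_A = g(A ·, ·)` at a point. -/
def fundamentalForm (g : ∀ x : M, LinearMap.BilinForm ℝ (TangentSpace I x))
    (A : ∀ x : M, TangentSpace I x →L[ℝ] TangentSpace I x)
    (x : M) (u v : TangentSpace I x) : ℝ :=
  g x (A x u) v

/-- The covariant derivative `(∇_X A) Y = ∇_X (A Y) - A (∇_X Y)`. -/
def covDerivEnd [IsManifold I ∞ M]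
    (cov : CovariantDerivative I E (TangentSpace I : M → Type _))
    (A : ∀ x : M, TangentSpace I x →L[ℝ] TangentSpace I x)
    (X Y : ∀ x : M, TangentSpace I x) (x : M) : TangentSpace I x :=
  cov (applyEnd A Y) x (X x) - A x (cov Y x (X x))

/-- The covariant exterior derivative `d^∇ A` of `A`, seen as a one-form with values in the
tangent bundle: `(d^∇ A)(X, Y) = ∇_X (A Y) - ∇_Y (A X) - A [X, Y]`. -/
def extCovDeriv [IsManifold I ∞ M]
    (cov : CovariantDerivative I E (TangentSpace I : M → Type _))
    (A : ∀ x : M, TangentSpace I x →L[ℝ] TangentSpace I x)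
    (X Y : ∀ x : M, TangentSpace I x) (x : M) : TangentSpace I x :=
  cov (applyEnd A Y) x (X x) - cov (applyEnd A X) x (Y x) - A x (VectorField.mlieBracket I X Y x)

/-- The product `α ∧_g β` of a `k`-form and an `l`-form with values in the tangent bundle, each
given by its values on vector fields. -/
def wedgeMetric (g : ∀ x : M, LinearMap.BilinForm ℝ (TangentSpace I x)) {k l : ℕ}
    (α : (Fin k → ∀ x : M, TangentSpace I x) → ∀ x : M, TangentSpace I x)
    (β : (Fin l → ∀ x : M, TangentSpace I x) → ∀ x : M, TangentSpace I x)
    (X : Fin (k + l) → ∀ x : M, TangentSpace I x) (x : M) : ℝ :=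
  1 / ((k ! : ℝ) * (l ! : ℝ)) * ∑ σ : Equiv.Perm (Fin (k + l)),
    ((Equiv.Perm.sign σ : ℤ) : ℝ) *
      g x (α (fun i => X (σ (Fin.castAdd l i))) x) (β (fun j => X (σ (Fin.natAdd k j))) x)

/-- The wedge product of a `k`-form and an `l`-form with real values, each given by its values
on vector fields. -/
def wedgeReal {k l : ℕ}
    (α : (Fin k → ∀ x : M, TangentSpace I x) → M → ℝ)
    (β : (Fin l → ∀ x : M, TangentSpace I x) → M → ℝ)
    (X : Fin (k + l) → ∀ x : M, TangentSpace I x) (x : M) : ℝ :=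
  1 / ((k ! : ℝ) * (l ! : ℝ)) * ∑ σ : Equiv.Perm (Fin (k + l)),
    ((Equiv.Perm.sign σ : ℤ) : ℝ) *
      (α (fun i => X (σ (Fin.castAdd l i))) x * β (fun j => X (σ (Fin.natAdd k j))) x)

/-- `d^∇ A` as a two-form with values in the tangent bundle. -/
def extCovDerivForm [IsManifold I ∞ M]
    (cov : CovariantDerivative I E (TangentSpace I : M → Type _))
    (A : ∀ x : M, TangentSpace I x →L[ℝ] TangentSpace I x)
    (X : Fin 2 → ∀ x : M, TangentSpace I x) : ∀ x : M, TangentSpace I x :=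
  extCovDeriv cov A (X 0) (X 1)

/-- `Ω_A` as a two-form with real values. -/
def fundamentalTwoForm (g : ∀ x : M, LinearMap.BilinForm ℝ (TangentSpace I x))
    (A : ∀ x : M, TangentSpace I x →L[ℝ] TangentSpace I x)
    (X : Fin 2 → ∀ x : M, TangentSpace I x) (x : M) : ℝ :=
  fundamentalForm g A x (X 0 x) (X 1 x)

end AlmostComplex

section RoundSphere

/-- The unit sphere of dimension `n` in `ℝ^(n+1)`, with its standard smooth structure. -/
abbrev UnitSphere (n : ℕ) : Type := Metric.sphere (0 : EuclideanSpace ℝ (Fin (n + 1))) 1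

/-- The inclusion of the unit sphere in Euclidean space. -/
def sphereInclusion (n : ℕ) (x : UnitSphere n) : EuclideanSpace ℝ (Fin (n + 1)) := x

/-- The differential of the inclusion at `x`, as a map from the tangent space to `ℝ^(n+1)`. -/
def inclusionDeriv (n : ℕ) (x : UnitSphere n) :
    TangentSpace (𝓡 n) x →L[ℝ] EuclideanSpace ℝ (Fin (n + 1)) :=
  mvfderiv (𝓡 n) (sphereInclusion n) x

/-- The round metric: the metric induced by the Euclidean inner product. -/
def roundMetric (n : ℕ) (x : UnitSphere n) : LinearMap.BilinForm ℝ (TangentSpace (𝓡 n) x) :=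
  (innerₗ (EuclideanSpace ℝ (Fin (n + 1)))).compl₁₂
    (inclusionDeriv n x).toLinearMap (inclusionDeriv n x).toLinearMap

theorem roundMetric_apply (n : ℕ) (x : UnitSphere n) (u v : TangentSpace (𝓡 n) x) :
    roundMetric n x u v = inner ℝ (inclusionDeriv n x u) (inclusionDeriv n x v) := rfl

theorem contMDiff_sphereInclusion (n : ℕ) :
    ContMDiff (𝓡 n) 𝓘(ℝ, EuclideanSpace ℝ (Fin (n + 1))) ∞ (sphereInclusion n) :=
  haveI := Fact.mk (@finrank_euclideanSpace_fin ℝ _ (n + 1))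
  contMDiff_coe_sphere

theorem inclusionDeriv_injective (n : ℕ) (x : UnitSphere n) :
    Function.Injective (inclusionDeriv n x) :=
  haveI := Fact.mk (@finrank_euclideanSpace_fin ℝ _ (n + 1))
  injective_mvfderiv_subtypeVal_sphere x

theorem inclusionDeriv_range (n : ℕ) (x : UnitSphere n) :
    (inclusionDeriv n x).range = (ℝ ∙ (x : EuclideanSpace ℝ (Fin (n + 1))))ᗮ :=
  haveI := Fact.mk (@finrank_euclideanSpace_fin ℝ _ (n + 1))
  range_mvfderiv_subtypeVal x

/-- The orthogonal projection of `ℝ^(n+1)` onto the tangent space of the sphere at `x`. -/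
def tangentialProjection (n : ℕ) (x : UnitSphere n) :
    EuclideanSpace ℝ (Fin (n + 1)) →L[ℝ] TangentSpace (𝓡 n) x :=
  LinearMap.toContinuousLinearMap
    ((LinearEquiv.ofInjective (inclusionDeriv n x).toLinearMap
        (inclusionDeriv_injective n x)).symm.toLinearMap ∘ₗ
      ((inclusionDeriv n x).range.orthogonalProjectionOnto).toLinearMap)

theorem inclusionDeriv_tangentialProjection (n : ℕ) (x : UnitSphere n)
    (w : EuclideanSpace ℝ (Fin (n + 1))) :
    inclusionDeriv n x (tangentialProjection n x w)
      = (inclusionDeriv n x).range.orthogonalProjectionOnto w := by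
  exact congrArg Subtype.val ((LinearEquiv.ofInjective (inclusionDeriv n x).toLinearMap
        (inclusionDeriv_injective n x)).apply_symm_apply
          ((inclusionDeriv n x).range.orthogonalProjectionOnto w))

theorem tangentialProjection_inclusionDeriv (n : ℕ) (x : UnitSphere n)
    (v : TangentSpace (𝓡 n) x) :
    tangentialProjection n x (inclusionDeriv n x v) = v := by
  apply inclusionDeriv_injective n x
  rw [inclusionDeriv_tangentialProjection]
  exact Submodule.starProjection_eq_self_iff.2 ⟨v, rfl⟩

theorem inner_inclusionDeriv_tangentialProjection (n : ℕ) (x : UnitSphere n)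
    (w : EuclideanSpace ℝ (Fin (n + 1))) (v : TangentSpace (𝓡 n) x) :
    inner ℝ (inclusionDeriv n x (tangentialProjection n x w)) (inclusionDeriv n x v)
      = inner ℝ w (inclusionDeriv n x v) := by
  rw [inclusionDeriv_tangentialProjection]
  exact Submodule.inner_orthogonalProjectionOnto_eq_of_mem_right
    (⟨inclusionDeriv n x v, ⟨v, rfl⟩⟩ : (inclusionDeriv n x).range) w

/-- A vector field on the sphere, seen as a function with values in `ℝ^(n+1)`. -/
def ambientField (n : ℕ) (Y : ∀ x : UnitSphere n, TangentSpace (𝓡 n) x) (x : UnitSphere n) :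
    EuclideanSpace ℝ (Fin (n + 1)) :=
  inclusionDeriv n x (Y x)


/-- The vector field `Y` on the sphere is differentiable at `x`. -/
def IsDifferentiableFieldAt {n : ℕ} (Y : ∀ x : UnitSphere n, TangentSpace (𝓡 n) x) (x : UnitSphere n) : Prop :=
  MDifferentiableAt (𝓡 n) (𝓡 n).tangent (fun y => (⟨y, Y y⟩ : TangentBundle (𝓡 n) (UnitSphere n))) x

theorem mdifferentiableAt_ambientField {n : ℕ} {Y : ∀ x : UnitSphere n, TangentSpace (𝓡 n) x}
    {x : UnitSphere n} (hY : IsDifferentiableFieldAt Y x) :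
    MDifferentiableAt (𝓡 n) 𝓘(ℝ, EuclideanSpace ℝ (Fin (n + 1))) (ambientField n Y) x := by
  have h1 := ((contMDiff_sphereInclusion n).contMDiff_tangentMap (m := 1)
    (by norm_cast)).mdifferentiable one_ne_zero
  have h2 := (h1 (⟨x, Y x⟩ : TangentBundle (𝓡 n) (UnitSphere n))).comp x hY
  have h4 := ((mdifferentiableAt_totalSpace _ _).1 h2).2
  simpa [Function.comp_def] using! h4

theorem ambientField_add {n : ℕ} (Y Z : ∀ x : UnitSphere n, TangentSpace (𝓡 n) x) :
    ambientField n (Y + Z) = ambientField n Y + ambientField n Z :=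
  funext fun y => (inclusionDeriv n y).map_add (Y y) (Z y)

theorem ambientField_smul {n : ℕ} (f : UnitSphere n → ℝ)
    (Y : ∀ x : UnitSphere n, TangentSpace (𝓡 n) x) :
    ambientField n (f • Y) = f • ambientField n Y :=
  funext fun y => (inclusionDeriv n y).map_smul (f y) (Y y)

/-- The Levi-Civita connection of the round metric: the tangential part of the Euclidean
directional derivative. `roundLeviCivita n Y x (X x)` is `∇_X Y` at `x`. That this is the unique
torsion-free metric connection is certified by `roundLeviCivita_metric` and
`roundLeviCivita_torsion` below. -/
def roundLeviCivita (n : ℕ) : CovariantDerivative (𝓡 n) (EuclideanSpace ℝ (Fin n))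
    (TangentSpace (𝓡 n) : UnitSphere n → Type) where
  toFun Y x := tangentialProjection n x ∘L mvfderiv (𝓡 n) (ambientField n Y) x
  isCovariantDerivativeOnUniv :=
    { add := by
        intro Y Z x hY hZ _
        have h := mvfderiv_add (mdifferentiableAt_ambientField hY)
          (mdifferentiableAt_ambientField hZ)
        rw [ambientField_add, h]
        exact ContinuousLinearMap.comp_add _ _ _
      leibniz := by
        intro Y f x hY hf _
        have h := mvfderiv_smul hf (mdifferentiableAt_ambientField hY)
        have h2 : tangentialProjection n x (ambientField n Y x) = Y x :=
          tangentialProjection_inclusionDeriv n x (Y x)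
        rw [ambientField_smul, h, ContinuousLinearMap.comp_add, ContinuousLinearMap.comp_smul]
        congr 1
        ext1 v
        rw [← h2]
        exact (tangentialProjection n x).map_smul _ _ }

/-- The connection is compatible with the round metric. -/
theorem roundLeviCivita_metric (n : ℕ) (x : UnitSphere n)
    (X Y Z : ∀ x : UnitSphere n, TangentSpace (𝓡 n) x) (hY : IsDifferentiableFieldAt Y x) (hZ : IsDifferentiableFieldAt Z x) :
    mvfderiv (𝓡 n) (fun y => roundMetric n y (Y y) (Z y)) x (X x) =
     roundMetric n x (roundLeviCivita n Y x (X x)) (Z x) + roundMetric n x (Y x) (roundLeviCivita n Z x (X x)) := by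
  have h1 := mdifferentiableAt_ambientField hY
  have h2 := mdifferentiableAt_ambientField hZ
  have h3 : HasFDerivAt (fun p : EuclideanSpace ℝ (Fin (n + 1)) × EuclideanSpace ℝ (Fin (n + 1)) =>
    inner ℝ p.1 p.2) _ (ambientField n Y x, ambientField n Z x) := hasFDerivAt_fst.inner ℝ hasFDerivAt_snd
  have h0 : HasMFDerivAt (𝓡 n) 𝓘(ℝ, EuclideanSpace ℝ (Fin (n + 1)) × EuclideanSpace ℝ (Fin (n + 1)))
      (fun y => (ambientField n Y y, ambientField n Z y)) x _ :=
    ⟨h1.continuousAt.prodMk h2.continuousAt, h1.hasMFDerivAt.2.prodMk h2.hasMFDerivAt.2⟩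
  have h4 := (h3.hasMFDerivAt.comp x h0).mfderiv
  have h5 : mvfderiv (𝓡 n) (fun y => roundMetric n y (Y y) (Z y)) x (X x) =
      inner ℝ (ambientField n Y x) (mvfderiv (𝓡 n) (ambientField n Z) x (X x)) +
      inner ℝ (mvfderiv (𝓡 n) (ambientField n Y) x (X x)) (ambientField n Z x) := by
    exact DFunLike.congr_fun h4 (X x)
  have h7 := inner_inclusionDeriv_tangentialProjection n x
    (mvfderiv (𝓡 n) (ambientField n Y) x (X x)) (Z x)
  have h8 := inner_inclusionDeriv_tangentialProjection n x
    (mvfderiv (𝓡 n) (ambientField n Z) x (X x)) (Y x)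
  rw [h5, roundMetric_apply, roundMetric_apply]
  rw [real_inner_comm, real_inner_comm (inclusionDeriv n x (Y x))] at h8
  exact (add_comm _ _).trans (congrArg₂ (· + ·) h7.symm h8.symm)

/-- In the ambient space, the Lie bracket is the commutator of directional derivatives. -/
theorem inclusionDeriv_mlieBracket (n : ℕ) (x : UnitSphere n) (X Y : ∀ x : UnitSphere n, TangentSpace (𝓡 n) x) 
    (hX : IsDifferentiableFieldAt X x) (hY : IsDifferentiableFieldAt Y x) :
    inclusionDeriv n x (VectorField.mlieBracket (𝓡 n) X Y x)
      = mvfderiv (𝓡 n) (ambientField n Y) x (X x) - mvfderiv (𝓡 n) (ambientField n X) x (Y x) := by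
  set f := sphereInclusion n ∘ (extChartAt (𝓡 n) x).symm with hf
  have key (Z : ∀ x : UnitSphere n, TangentSpace (𝓡 n) x) :
    (fun y => fderivWithin ℝ f (Set.range (𝓡 n)) y (VectorField.mpullbackWithin 𝓘(ℝ, EuclideanSpace ℝ (Fin n)) (𝓡 n) (extChartAt (𝓡 n) x).symm Z (Set.range (𝓡 n)) y))
      =ᶠ[nhds (extChartAt (𝓡 n) x x)] ambientField n Z ∘ (extChartAt (𝓡 n) x).symm := by
    filter_upwards [extChartAt_target_mem_nhds (I := 𝓡 n) x] with y hy
    have hinv := isInvertible_mfderivWithin_extChartAt_symm hy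
    have hc := mfderiv_comp_mfderivWithin (I := 𝓘(ℝ, EuclideanSpace ℝ (Fin n))) (I' := 𝓡 n)
      (I'' := 𝓘(ℝ, EuclideanSpace ℝ (Fin (n + 1)))) (s := Set.range (𝓡 n)) (x := y)
      (g := sphereInclusion n) (f := (extChartAt (𝓡 n) x).symm)
      ((contMDiff_sphereInclusion n).mdifferentiable (by simp) _)
      (mdifferentiableWithinAt_extChartAt_symm hy)
      ((𝓡 n).uniqueDiffOn.uniqueMDiffOn y (extChartAt_target_subset_range x hy))
    rw [mfderivWithin_eq_fderivWithin] at hc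
    have h1 := DFunLike.congr_fun hc (VectorField.mpullbackWithin 𝓘(ℝ, EuclideanSpace ℝ (Fin n)) (𝓡 n)
      (extChartAt (𝓡 n) x).symm Z (Set.range (𝓡 n)) y)
    refine h1.trans ?_
    have h2 : (mfderivWithin 𝓘(ℝ, EuclideanSpace ℝ (Fin n)) (𝓡 n) (extChartAt (𝓡 n) x).symm
        (Set.range (𝓡 n)) y) (VectorField.mpullbackWithin 𝓘(ℝ, EuclideanSpace ℝ (Fin n)) (𝓡 n)
      (extChartAt (𝓡 n) x).symm Z (Set.range (𝓡 n)) y) = Z ((extChartAt (𝓡 n) x).symm y) :=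
      hinv.self_apply_inverse _
    exact congrArg (inclusionDeriv n ((extChartAt (𝓡 n) x).symm y)) h2
  have hfs : ContDiffWithinAt ℝ 2 f (Set.range (𝓡 n)) (extChartAt (𝓡 n) x x) := by
    have := (contMDiffAt_iff.1 ((contMDiff_sphereInclusion n).of_le
      (show (2 : WithTop ℕ∞) ≤ ∞ by norm_cast) x)).2
    exact this
  have hd {Z : ∀ x : UnitSphere n, TangentSpace (𝓡 n) x} (hZ : IsDifferentiableFieldAt Z x) :
      DifferentiableWithinAt ℝ (VectorField.mpullbackWithin 𝓘(ℝ, EuclideanSpace ℝ (Fin n)) (𝓡 n)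
        (extChartAt (𝓡 n) x).symm Z (Set.range (𝓡 n))) (Set.range (𝓡 n)) (extChartAt (𝓡 n) x x) := by
    have h := mdifferentiableWithinAt_univ.2 hZ
    simpa using h.differentiableWithinAt_mpullbackWithin_vectorField
  have main := VectorField.fderivWithin_apply_lieBracket (n := 2) hfs (by simp) (𝓡 n).uniqueDiffOn
    (by simp) (by simp) (hd hY) (hd hX)
  rw [((key X).filter_mono nhdsWithin_le_nhds).fderivWithin_eq (key X).self_of_nhds,
    ((key Y).filter_mono nhdsWithin_le_nhds).fderivWithin_eq (key Y).self_of_nhds] at main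
  have hv (Z : ∀ x : UnitSphere n, TangentSpace (𝓡 n) x) :
      VectorField.mpullbackWithin 𝓘(ℝ, EuclideanSpace ℝ (Fin n)) (𝓡 n)
        (extChartAt (𝓡 n) x).symm Z (Set.range (𝓡 n)) (extChartAt (𝓡 n) x x) = Z x := by
    have hL : (mfderivWithin 𝓘(ℝ, EuclideanSpace ℝ (Fin n)) (𝓡 n) (extChartAt (𝓡 n) x).symm
        (Set.range (𝓡 n)) (extChartAt (𝓡 n) x x) :
          EuclideanSpace ℝ (Fin n) →L[ℝ] EuclideanSpace ℝ (Fin n))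
        = ContinuousLinearMap.id ℝ (EuclideanSpace ℝ (Fin n)) :=
      mfderivWithin_range_extChartAt_symm
    have h0 : (Z ((extChartAt (𝓡 n) x).symm (extChartAt (𝓡 n) x x)) : EuclideanSpace ℝ (Fin n))
        = Z x := by
      have (p : UnitSphere n) (hp : p = x) :
          (Z p : EuclideanSpace ℝ (Fin n)) = Z x := by subst hp; rfl
      exact this _ (extChartAt_to_inv (I := 𝓡 n) x)
    have h1 := congrArg (fun L : EuclideanSpace ℝ (Fin n) →L[ℝ] EuclideanSpace ℝ (Fin n) =>
      L.inverse (Z ((extChartAt (𝓡 n) x).symm (extChartAt (𝓡 n) x x)))) hL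
    refine h1.trans ?_
    simp only [ContinuousLinearMap.inverse_id]
    exact h0
  have hb : VectorField.mlieBracket (𝓡 n) X Y x = VectorField.lieBracketWithin ℝ
      (VectorField.mpullbackWithin 𝓘(ℝ, EuclideanSpace ℝ (Fin n)) (𝓡 n) (extChartAt (𝓡 n) x).symm X (Set.range (𝓡 n)))
      (VectorField.mpullbackWithin 𝓘(ℝ, EuclideanSpace ℝ (Fin n)) (𝓡 n) (extChartAt (𝓡 n) x).symm Y (Set.range (𝓡 n)))
      (Set.range (𝓡 n)) (extChartAt (𝓡 n) x x) := by
    have hL : (mfderiv (𝓡 n) 𝓘(ℝ, EuclideanSpace ℝ (Fin n)) (extChartAt (𝓡 n) x) x :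
          EuclideanSpace ℝ (Fin n) →L[ℝ] EuclideanSpace ℝ (Fin n))
        = ContinuousLinearMap.id ℝ (EuclideanSpace ℝ (Fin n)) :=
      mfderiv_extChartAt_self
    rw [← VectorField.mlieBracketWithin_univ, VectorField.mlieBracketWithin_apply,
      Set.preimage_univ, Set.univ_inter]
    have h1 := congrArg (fun L : EuclideanSpace ℝ (Fin n) →L[ℝ] EuclideanSpace ℝ (Fin n) =>
      L.inverse (VectorField.lieBracketWithin ℝ
      (VectorField.mpullbackWithin 𝓘(ℝ, EuclideanSpace ℝ (Fin n)) (𝓡 n) (extChartAt (𝓡 n) x).symm X (Set.range (𝓡 n)))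
      (VectorField.mpullbackWithin 𝓘(ℝ, EuclideanSpace ℝ (Fin n)) (𝓡 n) (extChartAt (𝓡 n) x).symm Y (Set.range (𝓡 n)))
      (Set.range (𝓡 n)) (extChartAt (𝓡 n) x x))) hL
    refine h1.trans ?_
    simp only [ContinuousLinearMap.inverse_id]
    rfl
  have hfx := MDifferentiableAt.mvfderiv
    ((contMDiff_sphereInclusion n).mdifferentiable (by simp) x)
  have hXx := (mdifferentiableAt_ambientField hX).mvfderiv
  have hYx := (mdifferentiableAt_ambientField hY).mvfderiv
  rw [hv X, hv Y] at main
  rw [hb, hXx, hYx]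
  refine Eq.trans ?_ main
  exact DFunLike.congr_fun hfx _

/-- The connection is torsion-free. -/
theorem roundLeviCivita_torsion (n : ℕ) : (roundLeviCivita n).torsion = 0 := by
  rw [CovariantDerivative.torsion_eq_zero_iff]
  intro X Y x hX hY
  apply inclusionDeriv_injective n x
  change inclusionDeriv n x (tangentialProjection n x (mvfderiv (𝓡 n) (ambientField n Y) x (X x))
    - tangentialProjection n x (mvfderiv (𝓡 n) (ambientField n X) x (Y x))) = _
  have h := inclusionDeriv_mlieBracket n x X Y hX hY
  rw [← map_sub, ← h]
  congr 1
  exact tangentialProjection_inclusionDeriv n x _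

end RoundSphere

end

/-! The hypotheses are contradictory: by LeBrun's theorem the round six-sphere has no orthogonal
complex structure, so every asserted identity holds vacuously. What is proved below is this
nonexistence.

Write `J x` for the structure at a unit vector `x`, extended by zero on the normal line. The
endomorphism `K = suspension (x, J x)` of `ℝ ⊕ ℝ⁷` is skew with `K² = -1`, so `x ↦ K` maps the
sphere to the orthogonal complex structures on an eight-dimensional space. Integrability says
exactly that this map is holomorphic, `dK (J X) = K dK X` (`integrability_of_symmetric`,
`suspension_mul`). The form `ω = τ (K dK dK)`, with `τ` the trace, is closed (`traceForm_closed`).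
It is nondegenerate because `ω(JX, X) = -τ (dK X dK X)`, which is positive for `X ≠ 0` since `dK X`
is skew and nonzero (`traceSuspension_mul_self_neg`).

A closed nondegenerate two-form on the six-sphere is impossible because `ω³` would be an exact
volume form. This is carried out on `ℝ⁶` in stereographic coordinates, where the conformal factor
gives `ω = O((1 + ‖y‖²)⁻²)`. With a primitive `α = O(‖y‖)` from the Poincaré lemma, the Pfaffian of
`ω` is, up to a factor, the divergence of the contraction of `ω ∧ ω` with `α`. That field is
`O(‖y‖⁻⁷)`, so its flux through large spheres tends to zero and its divergence cannot have one sign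
(`exists_pfaffianSix_eq_zero`, `false_of_holomorphic_complexStructure`). -/

noncomputable section

/-! ### Pfaffians of skew-symmetric matrices and the identity behind the exactness of `ω³`. -/

/-- The Pfaffian of the `4 × 4` minor of `b` with rows and columns `r`. -/
def pfaffianFour {n : ℕ} (b : Fin n → Fin n → ℝ) (r : Fin 4 → Fin n) : ℝ :=
  b (r 0) (r 1) * b (r 2) (r 3) - b (r 0) (r 2) * b (r 1) (r 3) + b (r 0) (r 3) * b (r 1) (r 2)

/-- The signed complementary `4 × 4` Pfaffian of `b` at the entry `(i, i.succAbove j)`. -/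
def pfaffianCofactor (b : Fin 6 → Fin 6 → ℝ) (i : Fin 6) (j : Fin 5) : ℝ :=
  (-1) ^ (i + j : ℕ) * pfaffianFour b (fun k => i.succAbove (j.succAbove k))

/-- The Pfaffian of a skew-symmetric `6 × 6` matrix, expanded along the first row. -/
def pfaffianSix (b : Fin 6 → Fin 6 → ℝ) : ℝ :=
  ∑ j : Fin 5, b 0 (Fin.succAbove 0 j) * pfaffianCofactor b 0 j

/-- Turns a zero of the Pfaffian into a kernel vector of the form. -/
theorem det_eq_pfaffianSix_sq (b : Fin 6 → Fin 6 → ℝ) (hb : ∀ i j, b i j = -b j i) :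
    (Matrix.of b).det = pfaffianSix b ^ 2 := by
  have h0 (i) : b i i = 0 := by linarith [hb i i]
  have e : Matrix.of b = !![0, b 0 1, b 0 2, b 0 3, b 0 4, b 0 5;
      -b 0 1, 0, b 1 2, b 1 3, b 1 4, b 1 5;
      -b 0 2, -b 1 2, 0, b 2 3, b 2 4, b 2 5;
      -b 0 3, -b 1 3, -b 2 3, 0, b 3 4, b 3 5;
      -b 0 4, -b 1 4, -b 2 4, -b 3 4, 0, b 4 5;
      -b 0 5, -b 1 5, -b 2 5, -b 3 5, -b 4 5, 0] := by
    ext i j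
    fin_cases i <;> fin_cases j <;> simp [h0] <;> exact hb _ _
  rw [e]
  simp [Matrix.det_succ_row_zero, Fin.sum_univ_succ, pfaffianSix, pfaffianCofactor, pfaffianFour, Fin.succAbove]
  ring

/-- The derivative of `pfaffianFour` at `b` in the direction `c`. -/
def pfaffianFourDeriv {n : ℕ} (b c : Fin n → Fin n → ℝ) (r : Fin 4 → Fin n) : ℝ :=
  (c (r 0) (r 1) * b (r 2) (r 3) + b (r 0) (r 1) * c (r 2) (r 3))
    - (c (r 0) (r 2) * b (r 1) (r 3) + b (r 0) (r 2) * c (r 1) (r 3))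
    + (c (r 0) (r 3) * b (r 1) (r 2) + b (r 0) (r 3) * c (r 1) (r 2))

/-- `pfaffianFour` is a component of `ω ∧ ω / 2`, so the alternating sum is a component of `d(ω ∧ ω
/ 2) = dω ∧ ω`. Each of the ten triples of indices contributes a component of `dω` times the entry
of `ω` at the complementary pair. -/
theorem sum_pfaffianFourDeriv_eq_zero {n : ℕ} (b : Fin n → Fin n → ℝ)
    (db : Fin n → Fin n → Fin n → ℝ) (hdb : ∀ k i j, db k i j = -db k j i)
    (hcl : ∀ i j k, db i j k + db j k i + db k i j = 0) (r : Fin 5 → Fin n) :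
    ∑ i : Fin 5, (-1) ^ (i : ℕ) * pfaffianFourDeriv b (db (r i)) (fun k => r (i.succAbove k))
      = 0 := by
  have h (i j k) : db i j k - db j i k + db k i j = 0 := by
    linarith [hcl i j k, hdb j i k]
  simp [Fin.sum_univ_succ, pfaffianFourDeriv, Fin.succAbove]
  linear_combination b (r 3) (r 4) * h (r 0) (r 1) (r 2) - b (r 2) (r 4) * h (r 0) (r 1) (r 3)
    + b (r 2) (r 3) * h (r 0) (r 1) (r 4) + b (r 1) (r 4) * h (r 0) (r 2) (r 3)
    - b (r 1) (r 3) * h (r 0) (r 2) (r 4) + b (r 1) (r 2) * h (r 0) (r 3) (r 4)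
    - b (r 0) (r 4) * h (r 1) (r 2) (r 3) + b (r 0) (r 3) * h (r 1) (r 2) (r 4)
    - b (r 0) (r 2) * h (r 1) (r 3) (r 4) + b (r 0) (r 1) * h (r 2) (r 3) (r 4)

/-- The divergence of the contraction of `ω ∧ ω` with a primitive of the closed two-form `ω` is
three times the Pfaffian of `ω`, in terms of first derivatives at a point. -/
theorem sum_pfaffianCofactor (b : Fin 6 → Fin 6 → ℝ)
    (db : Fin 6 → Fin 6 → Fin 6 → ℝ) (hdb : ∀ k i j, db k i j = -db k j i)
    (hcl : ∀ i j k, db i j k + db j k i + db k i j = 0)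
    (a : Fin 6 → ℝ) (da : Fin 6 → Fin 6 → ℝ) (hda : ∀ i j, da i j - da j i = b i j) :
    ∑ i : Fin 6, ∑ j : Fin 5,
      ((-1) ^ (i + j : ℕ) * pfaffianFourDeriv b (db i) (fun k => i.succAbove (j.succAbove k))
          * a (i.succAbove j)
        + pfaffianCofactor b i j * da i (i.succAbove j)) = 3 * pfaffianSix b := by
  -- The coefficient of `a j` is a component of `dω ∧ ω` on the five other indices, hence zero. In
  -- the remaining terms the cofactors are antisymmetric, so `da` enters only through `b`. Summing
  -- entry times cofactor over unordered pairs gives `3 Pf`, since each of the six row expansions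
  -- gives `Pf` and each pair occurs in two of them.
  have hcol (j : Fin 6) := sum_pfaffianFourDeriv_eq_zero b db hdb hcl j.succAbove
  have h0 := hcol 0
  have h1 := hcol 1
  have h2 := hcol 2
  have h3 := hcol 3
  have h4 := hcol 4
  have h5 := hcol 5
  simp [Fin.sum_univ_succ, pfaffianFourDeriv, Fin.succAbove] at h0 h1 h2 h3 h4 h5
  simp [Fin.sum_univ_succ, pfaffianSix, pfaffianCofactor, pfaffianFour, pfaffianFourDeriv, Fin.succAbove]
  have hda' (i j) : da j i = da i j - b i j := by linarith [hda i j]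
  rw [hda' 0 1, hda' 0 2, hda' 0 3, hda' 0 4, hda' 0 5, hda' 1 2, hda' 1 3, hda' 1 4, hda' 1 5,
    hda' 2 3, hda' 2 4, hda' 2 5, hda' 3 4, hda' 3 5, hda' 4 5]
  linear_combination -a 0 * h0 + a 1 * h1 - a 2 * h2 + a 3 * h3 - a 4 * h4 + a 5 * h5

/-! ### The Poincaré lemma and the divergence theorem on Euclidean space. -/

open MeasureTheory in
/-- Differentiation under the integral sign for a continuously differentiable integrand. -/
theorem hasFDerivAt_integral_of_contDiff {E : Type*} [NormedAddCommGroup E] [NormedSpace ℝ E]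
    [ProperSpace E] {F : E → ℝ → ℝ} (hF : ContDiff ℝ 1 (Function.uncurry F)) (y : E) :
    HasFDerivAt (fun y => ∫ t in (0 : ℝ)..1, F y t)
      (∫ t in (0 : ℝ)..1, fderiv ℝ (fun y => F y t) y) y ∧
      (Continuous fun y => ∫ t in (0 : ℝ)..1, fderiv ℝ (fun y => F y t) y) ∧
      Continuous fun t => fderiv ℝ (fun y => F y t) y := by
  have hd (y : E) (t : ℝ) : HasFDerivAt (fun y => F y t)
      (fderiv ℝ (Function.uncurry F) (y, t) ∘L ContinuousLinearMap.inl ℝ E ℝ) y :=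
    HasFDerivAt.comp (f := fun y => (y, t)) (g := Function.uncurry F) y
      ((hF.differentiable one_ne_zero) (y, t)).hasFDerivAt
      (hasFDerivAt_prodMk_left (𝕜 := ℝ) y t)
  have hc : Continuous (Function.uncurry fun y t => fderiv ℝ (fun y => F y t) y) := by
    have : (Function.uncurry fun y t => fderiv ℝ (fun y => F y t) y) = fun p : E × ℝ =>
        fderiv ℝ (Function.uncurry F) p ∘L ContinuousLinearMap.inl ℝ E ℝ := by
      ext1 p
      exact (hd p.1 p.2).fderiv
    rw [this]
    exact (hF.continuous_fderiv one_ne_zero).clm_comp continuous_const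
  have hFt (y : E) : Continuous (F y) := hF.continuous.comp (by fun_prop : Continuous (Prod.mk y))
  refine ⟨?_, intervalIntegral.continuous_parametric_intervalIntegral_of_continuous' hc 0 1,
    hc.comp (by fun_prop : Continuous (Prod.mk y))⟩
  obtain ⟨C, hC⟩ := ((isCompact_closedBall y 1).prod
    (isCompact_Icc (a := (0 : ℝ)) (b := 1))).exists_bound_of_continuousOn hc.continuousOn
  refine intervalIntegral.hasFDerivAt_integral_of_dominated_of_fderiv_le (bound := fun _ => C)
    (F' := fun y t => fderiv ℝ (fun y => F y t) y)
    (Metric.closedBall_mem_nhds y one_pos) (.of_forall fun x => (hFt x).aestronglyMeasurable)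
    ((hFt y).intervalIntegrable _ _)
    (hc.comp (by fun_prop : Continuous (Prod.mk y))).aestronglyMeasurable
    (.of_forall fun t ht x hx => ?_) intervalIntegrable_const (.of_forall fun t ht x hx => ?_)
  · rw [Set.uIoc_of_le zero_le_one] at ht
    exact hC (x, t) ⟨hx, ht.1.le, ht.2⟩
  · rw [(hd x t).fderiv]
    exact hd x t

/-- The **Poincaré lemma** for two-forms on Euclidean space, in coordinates, with an estimate. -/
theorem exists_primitive_of_closed {n : ℕ} {b : EuclideanSpace ℝ (Fin n) → Fin n → Fin n → ℝ}
    (hb : ∀ i j, ContDiff ℝ 1 (fun y => b y i j)) (hskew : ∀ y i j, b y i j = -b y j i)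
    (hcl : ∀ y i j k, fderiv ℝ (fun y => b y j k) y (EuclideanSpace.single i 1)
      + fderiv ℝ (fun y => b y k i) y (EuclideanSpace.single j 1)
      + fderiv ℝ (fun y => b y i j) y (EuclideanSpace.single k 1) = 0)
    {C : ℝ} (hC : ∀ y i j, |b y i j| ≤ C) :
    ∃ α : EuclideanSpace ℝ (Fin n) → Fin n → ℝ, (∀ j, ContDiff ℝ 1 (fun y => α y j)) ∧
      (∀ y i j, fderiv ℝ (fun y => α y j) y (EuclideanSpace.single i 1)
        - fderiv ℝ (fun y => α y i) y (EuclideanSpace.single j 1) = b y i j) ∧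
      ∀ y j, |α y j| ≤ n * C * ‖y‖ := by
  -- The radial homotopy operator: the primitive is the integral over `t ∈ [0, 1]` of the form at `t
  -- y` contracted with `t y`.
  set F : Fin n → EuclideanSpace ℝ (Fin n) → ℝ → ℝ := fun j y t => ∑ k, t * y k * b (t • y) k j
    with hFdef
  have hF (j) : ContDiff ℝ 1 (Function.uncurry (F j)) := by
    have (k : Fin n) (j : Fin n) : ContDiff ℝ 1 (fun p : EuclideanSpace ℝ (Fin n) × ℝ => b (p.2 • p.1) k j) :=
      (hb k j).comp (contDiff_snd.smul contDiff_fst)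
    simp only [hFdef, Function.uncurry_def]
    fun_prop
  have hdb (k j) (y) : HasFDerivAt (fun y => b y k j) (fderiv ℝ (fun y => b y k j) y) y :=
    ((hb k j).differentiable one_ne_zero y).hasFDerivAt
  have hdF (i j) (y : EuclideanSpace ℝ (Fin n)) (t : ℝ) :
      fderiv ℝ (fun y => F j y t) y (EuclideanSpace.single i 1) = t * b (t • y) i j
        + ∑ k, t * y k * (t * fderiv ℝ (fun y => b y k j) (t • y) (EuclideanSpace.single i 1)) := by
    have h (k) : HasFDerivAt (fun y : EuclideanSpace ℝ (Fin n) => t * y k * b (t • y) k j)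
        ((t * y k) • (fderiv ℝ (fun y => b y k j) (t • y) ∘L
          (t • ContinuousLinearMap.id ℝ (EuclideanSpace ℝ (Fin n))))
          + b (t • y) k j • (t • EuclideanSpace.proj k)) y := by
      have h1 : HasFDerivAt (fun y : EuclideanSpace ℝ (Fin n) => y k)
        (EuclideanSpace.proj k : EuclideanSpace ℝ (Fin n) →L[ℝ] ℝ) y :=
        (EuclideanSpace.proj k : EuclideanSpace ℝ (Fin n) →L[ℝ] ℝ).hasFDerivAt
      exact (h1.const_mul t).mul
        ((hdb k j (t • y)).comp y ((hasFDerivAt_id y).const_smul t))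
    rw [(HasFDerivAt.fun_sum fun k _ => h k).fderiv]
    simp [Finset.sum_add_distrib, add_comm, mul_comm]
  have hα (j) := fun y => (hasFDerivAt_integral_of_contDiff (hF j) y)
  have hFc (j) (y) : Continuous fun t => fderiv ℝ (fun y => F j y t) y :=
    (hα j y).2.2
  refine ⟨fun y j => ∫ t in (0 : ℝ)..1, F j y t, fun j => ?_, fun y i j => ?_, fun y j => ?_⟩
  · rw [contDiff_one_iff_fderiv]
    refine ⟨fun y => (hα j y).1.differentiableAt, ?_⟩
    rw [show fderiv ℝ (fun y => ∫ t in (0 : ℝ)..1, F j y t) = _ from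
      funext fun y => (hα j y).1.fderiv]
    exact (hα j 0).2.1
  · rw [(hα j y).1.fderiv, (hα i y).1.fderiv,
      ContinuousLinearMap.intervalIntegral_apply ((hFc j y).intervalIntegrable _ _),
      ContinuousLinearMap.intervalIntegral_apply ((hFc i y).intervalIntegrable _ _),
      ← intervalIntegral.integral_sub (((hFc j y).clm_apply continuous_const).intervalIntegrable _ _)
       (((hFc i y).clm_apply continuous_const).intervalIntegrable _ _)]
    -- Closedness makes the exterior derivative of the integrand a total `t`-derivative, so the
    -- integral is the value of `t² b(ty)` at `t = 1`.
    have hder (t : ℝ) : HasDerivAt (fun t : ℝ => t ^ 2 * b (t • y) i j)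
        (fderiv ℝ (fun y => F j y t) y (EuclideanSpace.single i 1)
          - fderiv ℝ (fun y => F i y t) y (EuclideanSpace.single j 1)) t := by
      have h1 : HasDerivAt (fun t : ℝ => b (t • y) i j) (fderiv ℝ (fun y => b y i j) (t • y) y) t := by
        have := (hdb i j (t • y)).comp_hasDerivAt t ((hasDerivAt_id t).smul_const y)
        simpa [Function.comp_def] using this
      refine (((hasDerivAt_pow 2 t)).mul h1).congr_deriv ?_
      have h2 : fderiv ℝ (fun y => b y i j) (t • y) y
          = ∑ k, y k * fderiv ℝ (fun y => b y i j) (t • y) (EuclideanSpace.single k 1) := by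
        conv_lhs => enter [2]; rw [← (EuclideanSpace.basisFun (Fin n) ℝ).sum_repr y]
        simp only [map_sum, map_smul, smul_eq_mul, EuclideanSpace.basisFun_repr,
          EuclideanSpace.basisFun_apply]
      rw [hdF, hdF, h2, hskew _ j i, Finset.mul_sum]
      have h3 : ∀ k, fderiv ℝ (fun y => b y i j) (t • y) (EuclideanSpace.single k 1)
        = fderiv ℝ (fun y => b y k j) (t • y) (EuclideanSpace.single i 1)
        - fderiv ℝ (fun y => b y k i) (t • y) (EuclideanSpace.single j 1) := by
        intro k
        have h4 : fderiv ℝ (fun y => b y k j) (t • y) (EuclideanSpace.single i 1)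
            = - fderiv ℝ (fun y => b y j k) (t • y) (EuclideanSpace.single i 1) := by
          rw [show (fun y => b y k j) = fun y => -b y j k from funext fun y => hskew y k j,
            fderiv_fun_neg]
          rfl
        linarith [hcl (t • y) i j k]
      simp only [h3]
      rw [add_sub_add_comm, ← Finset.sum_sub_distrib]
      congr 1
      · push_cast; ring
      · exact Finset.sum_congr rfl fun k _ => by ring
    rw [intervalIntegral.integral_eq_sub_of_hasDerivAt (fun t _ => hder t)
      ((((hFc j y).clm_apply continuous_const).sub
       ((hFc i y).clm_apply continuous_const)).intervalIntegrable _ _)]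
    simp
  · have hC0 : 0 ≤ C := (abs_nonneg _).trans (hC 0 j j)
    suffices h : ‖∫ t in (0 : ℝ)..1, F j y t‖ ≤ n * C * ‖y‖ * |1 - 0| by simpa using h
    refine intervalIntegral.norm_integral_le_of_norm_le_const fun t ht => ?_
    rw [Set.uIoc_of_le zero_le_one] at ht
    refine (norm_sum_le _ _).trans ?_
    refine (Finset.sum_le_card_nsmul _ _ (C * ‖y‖) fun k _ => ?_).trans (by simp [mul_assoc])
    rw [norm_mul, norm_mul, Real.norm_eq_abs t, abs_of_pos ht.1, mul_comm C]
    have h1 : ‖y k‖ ≤ ‖y‖ := PiLp.norm_apply_le y k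
    have h2 : t * ‖y k‖ ≤ ‖y‖ := by nlinarith [norm_nonneg (y k), ht.1, ht.2]
    exact mul_le_mul h2 (hC _ _ _) (norm_nonneg _) (norm_nonneg _)

open MeasureTheory in
/-- Integration by parts for the divergence of a vector field against a compactly supported
function. -/
theorem integral_mul_divergence {n : ℕ} {χ : EuclideanSpace ℝ (Fin n) → ℝ} (hχ : ContDiff ℝ 1 χ)
    (hsupp : HasCompactSupport χ) {W : EuclideanSpace ℝ (Fin n) → Fin n → ℝ}
    (hW : ∀ i, ContDiff ℝ 1 (fun y => W y i)) :
    ∫ y, χ y * ∑ i, fderiv ℝ (fun y => W y i) y (EuclideanSpace.single i 1)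
      = -∫ y, ∑ i, fderiv ℝ χ y (EuclideanSpace.single i 1) * W y i := by
  have hc (i) : Continuous fun y => fderiv ℝ (fun y => W y i) y (EuclideanSpace.single i 1) :=
    ((hW i).continuous_fderiv one_ne_zero).clm_apply continuous_const
  have hd (i) : Continuous fun y => fderiv ℝ χ y (EuclideanSpace.single i 1) :=
    (hχ.continuous_fderiv one_ne_zero).clm_apply continuous_const
  have h1 (i) : Integrable fun y =>
      χ y * fderiv ℝ (fun y => W y i) y (EuclideanSpace.single i 1) :=
    (hχ.continuous.mul (hc i)).integrable_of_hasCompactSupport hsupp.mul_right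
  have h2 (i) : Integrable fun y => fderiv ℝ χ y (EuclideanSpace.single i 1) * W y i :=
    ((hd i).mul (hW i).continuous).integrable_of_hasCompactSupport
      (hsupp.fderiv_apply ℝ _).mul_right
  simp only [Finset.mul_sum]
  rw [integral_finsetSum _ fun i _ => h1 i, integral_finsetSum _ fun i _ => h2 i,
    ← Finset.sum_neg_distrib]
  refine Finset.sum_congr rfl fun i _ => ?_
  exact integral_mul_fderiv_eq_neg_fderiv_mul_of_integrable (h2 i) (h1 i)
    ((hχ.continuous.mul (hW i).continuous).integrable_of_hasCompactSupport hsupp.mul_right)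
    (fun y _ => hχ.differentiable one_ne_zero y) (fun y _ => (hW i).differentiable one_ne_zero y)

open MeasureTheory in
/-- A vector field on `ℝⁿ` which decays like `‖y‖⁻ⁿ` cannot have everywhere positive divergence. -/
theorem not_forall_divergence_pos {n : ℕ} {W : EuclideanSpace ℝ (Fin n) → Fin n → ℝ}
    (hW : ∀ i, ContDiff ℝ 1 (fun y => W y i)) {C : ℝ} (hC : ∀ y i, ‖y‖ ^ n * |W y i| ≤ C) :
    ¬ ∀ y, 0 < ∑ i, fderiv ℝ (fun y => W y i) y (EuclideanSpace.single i 1) := by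
  intro hpos
  set g := fun y => ∑ i, fderiv ℝ (fun y => W y i) y (EuclideanSpace.single i 1) with hg
  have hgc : Continuous g := continuous_finsetSum _ fun i _ =>
    ((hW i).continuous_fderiv one_ne_zero).clm_apply continuous_const
  let f : ContDiffBump (0 : EuclideanSpace ℝ (Fin n)) := ⟨1, 2, one_pos, one_lt_two⟩
  have hf : ContDiff ℝ 1 f := f.contDiff
  obtain ⟨M, hM⟩ := (f.hasCompactSupport.fderiv ℝ).exists_bound_of_continuous
    (hf.continuous_fderiv one_ne_zero)
  have hM0 : 0 ≤ M := (norm_nonneg _).trans (hM 0)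
  have hC0 (i : Fin n) : 0 ≤ C := (mul_nonneg (by positivity) (abs_nonneg _)).trans (hC 0 i)
  set c₀ := ∫ y in Metric.closedBall 0 1, g y with hc₀
  have hint : IntegrableOn g (Metric.closedBall 0 1) :=
    hgc.continuousOn.integrableOn_compact (isCompact_closedBall _ _)
  have hc₀pos : 0 < c₀ := by
    rw [hc₀, setIntegral_pos_iff_support_of_nonneg_ae (.of_forall fun y => (hpos y).le) hint]
    have : Function.support g = Set.univ := Set.eq_univ_of_forall fun y => (hpos y).ne'
    rw [this, Set.univ_inter]
    exact Metric.measure_closedBall_pos _ _ one_pos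
  set v := volume.real (Metric.closedBall (0 : EuclideanSpace ℝ (Fin n)) 1) with hv
  -- Test the divergence against the bump rescaled by `R`. Its gradient is at most `M / R` and lives
  -- on `R ≤ ‖y‖ ≤ 2R`, where `|W| ≤ C / Rⁿ`. The ball of radius `2R` has volume `(2R)ⁿ v`, so the
  -- powers `Rⁿ` cancel and a factor `1 / R` is left.
  have key (R : ℝ) (hR : 1 ≤ R) : c₀ ≤ n * (M * C * 2 ^ n * v) / R := by
    have hR0 : 0 < R := one_pos.trans_le hR
    set χ : EuclideanSpace ℝ (Fin n) → ℝ := fun y => f (R⁻¹ • y) with hχdef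
    have hχ : ContDiff ℝ 1 χ := hf.comp (contDiff_const_smul _)
    have hsupp : HasCompactSupport χ :=
      f.hasCompactSupport.comp_homeomorph (Homeomorph.smulOfNeZero R⁻¹ (inv_ne_zero hR0.ne'))
    have hdχ (y) : fderiv ℝ χ y = R⁻¹ • fderiv ℝ f (R⁻¹ • y) := by
      exact fderiv_comp_smul R⁻¹
    have h1 : c₀ ≤ ∫ y, χ y * g y := by
      have hχg : Integrable fun y => χ y * g y :=
        (hχ.continuous.mul hgc).integrable_of_hasCompactSupport hsupp.mul_right
      refine le_trans (le_of_eq ?_) (setIntegral_le_integral hχg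
        (.of_forall fun y => mul_nonneg f.nonneg (hpos y).le) (s := Metric.closedBall 0 1))
      refine setIntegral_congr_fun measurableSet_closedBall fun y hy => ?_
      have : χ y = 1 := by
        refine f.one_of_mem_closedBall ?_
        rw [mem_closedBall_zero_iff] at hy ⊢
        rw [norm_smul, norm_inv, Real.norm_of_nonneg hR0.le]
        exact (mul_le_of_le_one_left (norm_nonneg _) (inv_le_one_of_one_le₀ hR)).trans hy
      simp [this]
    refine h1.trans ?_
    rw [integral_mul_divergence hχ hsupp hW]
    refine (neg_le_abs _).trans ?_
    set D := n * (R⁻¹ * M * (C * (R ^ n)⁻¹)) with hD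
    have hbd (y) : ‖∑ i, fderiv ℝ χ y (EuclideanSpace.single i 1) * W y i‖
        ≤ (Metric.closedBall (0 : EuclideanSpace ℝ (Fin n)) (2 * R)).indicator (fun _ => D) y := by
      have hy0 (h : fderiv ℝ f (R⁻¹ • y) = 0) :
          ‖∑ i, fderiv ℝ χ y (EuclideanSpace.single i 1) * W y i‖ = 0 := by
        simp [hdχ, h]
      have hny : ‖R⁻¹ • y‖ = R⁻¹ * ‖y‖ := by
        rw [norm_smul, norm_inv, Real.norm_of_nonneg hR0.le]
      have hD0 : 0 ≤ D := by
        -- For `n = 0` the bound by `C` is an empty condition and `C` may be negative; the factor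
        -- `n` in `D` then vanishes.
        rcases Nat.eq_zero_or_pos n with rfl | hn
        · simp [hD]
        · have := hC0 ⟨0, hn⟩
          positivity
      by_cases hy : y ∈ Metric.closedBall (0 : EuclideanSpace ℝ (Fin n)) (2 * R)
      · rw [Set.indicator_of_mem hy]
        by_cases hy1 : ‖y‖ < R
        · rw [hy0]
          · exact hD0
          · have : f =ᶠ[nhds (R⁻¹ • y)] fun _ => 1 := by
              refine f.eventuallyEq_one_of_mem_ball ?_
              rw [mem_ball_zero_iff, hny]
              change _ < 1
              rwa [inv_mul_lt_iff₀ hR0, mul_one]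
            rw [this.fderiv_eq, fderiv_const_apply]
        · refine (norm_sum_le _ _).trans ((Finset.sum_le_card_nsmul _ _
            (R⁻¹ * M * (C * (R ^ n)⁻¹)) fun i _ => ?_).trans (by simp [hD]))
          rw [norm_mul]
          have hC0 := hC0 i
          refine mul_le_mul ?_ ?_ (norm_nonneg _) (by positivity)
          · refine (ContinuousLinearMap.le_opNorm _ _).trans ?_
            rw [hdχ, norm_smul, norm_inv, Real.norm_of_nonneg hR0.le, PiLp.norm_single,
              norm_one, mul_one]
            gcongr
            exact hM _
          · rw [← div_eq_mul_inv, le_div_iff₀' (by positivity)]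
            refine le_trans ?_ (hC y i)
            rw [Real.norm_eq_abs]
            gcongr
            exact not_lt.1 hy1
      · rw [Set.indicator_of_notMem hy, hy0]
        refine image_eq_zero_of_notMem_tsupport fun h => hy ?_
        have h2 := (tsupport_fderiv_subset ℝ) h
        rw [f.tsupport_eq, mem_closedBall_zero_iff, hny, inv_mul_le_iff₀ hR0] at h2
        rw [mem_closedBall_zero_iff, mul_comm]
        exact h2
    rw [← Real.norm_eq_abs]
    refine (norm_integral_le_of_norm_le ?_ (.of_forall hbd)).trans ?_
    · exact (integrable_indicator_iff measurableSet_closedBall).2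
        (integrableOn_const (measure_closedBall_lt_top).ne)
    · rw [integral_indicator_const _ measurableSet_closedBall, measureReal_def,
        Measure.addHaar_closedBall' _ _ (by positivity)]
      rw [ENNReal.toReal_mul, ENNReal.toReal_ofReal (by positivity), finrank_euclideanSpace_fin,
        ← measureReal_def, ← hv, hD, smul_eq_mul, mul_pow]
      refine le_of_eq ?_
      field_simp
  obtain ⟨R, hR⟩ := exists_gt (max 1 (n * (M * C * 2 ^ n * v) / c₀))
  have hR1 := (le_max_left _ _).trans hR.le
  have h1 := key R hR1
  have h2 := (le_max_right _ _).trans_lt hR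
  rw [le_div_iff₀ (one_pos.trans_le hR1)] at h1
  rw [div_lt_iff₀ hc₀pos] at h2
  linarith

/-! ### Closed decaying two-forms on `ℝ⁶` degenerate somewhere. -/

theorem fderiv_pfaffianCofactor {E : Type*} [NormedAddCommGroup E] [NormedSpace ℝ E]
    {b : E → Fin 6 → Fin 6 → ℝ} {y : E} (hb : ∀ i j, DifferentiableAt ℝ (fun y => b y i j) y)
    (i : Fin 6) (j : Fin 5) (v : E) :
    DifferentiableAt ℝ (fun y => pfaffianCofactor (b y) i j) y ∧
      fderiv ℝ (fun y => pfaffianCofactor (b y) i j) y v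
      = (-1) ^ (i + j : ℕ) * pfaffianFourDeriv (b y) (fun k l => fderiv ℝ (fun y => b y k l) y v)
          (fun k => i.succAbove (j.succAbove k)) := by
  have h (k l) := (hb k l).hasFDerivAt
  have h1 (r : Fin 4 → Fin 6) := ((((h (r 0) (r 1)).mul (h (r 2) (r 3))).sub
    ((h (r 0) (r 2)).mul (h (r 1) (r 3)))).add
    ((h (r 0) (r 3)).mul (h (r 1) (r 2)))).const_mul ((-1 : ℝ) ^ (i + j : ℕ))
  have h2 : HasFDerivAt (fun y => pfaffianCofactor (b y) i j) _ y :=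
    h1 (fun k => i.succAbove (j.succAbove k))
  refine ⟨h2.differentiableAt, ?_⟩
  rw [h2.fderiv]
  simp [pfaffianFourDeriv]
  ring

theorem abs_pfaffianCofactor_le {b : Fin 6 → Fin 6 → ℝ} {B : ℝ} (hB : ∀ i j, |b i j| ≤ B)
    (i : Fin 6) (j : Fin 5) : |pfaffianCofactor b i j| ≤ 3 * B ^ 2 := by
  have hB0 : 0 ≤ B := (abs_nonneg _).trans (hB 0 0)
  have h (k l m n) : |b k l * b m n| ≤ B ^ 2 := by
    rw [abs_mul, sq]
    exact mul_le_mul (hB _ _) (hB _ _) (abs_nonneg _) hB0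
  rw [pfaffianCofactor, abs_mul, abs_neg_one_pow, one_mul, pfaffianFour]
  refine (abs_add_le _ _).trans ?_
  refine (add_le_add ((abs_sub _ _).trans (add_le_add (h _ _ _ _) (h _ _ _ _)))
    (h _ _ _ _)).trans ?_
  linarith

/-- A closed two-form on `ℝ⁶` which decays like `‖y‖⁻⁴` degenerates at some point. -/
theorem exists_pfaffianSix_eq_zero {b : EuclideanSpace ℝ (Fin 6) → Fin 6 → Fin 6 → ℝ}
    (hb : ∀ i j, ContDiff ℝ 1 (fun y => b y i j)) (hskew : ∀ y i j, b y i j = -b y j i)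
    (hcl : ∀ y i j k, fderiv ℝ (fun y => b y j k) y (EuclideanSpace.single i 1)
      + fderiv ℝ (fun y => b y k i) y (EuclideanSpace.single j 1)
      + fderiv ℝ (fun y => b y i j) y (EuclideanSpace.single k 1) = 0)
    {C : ℝ} (hC : ∀ y i j, |b y i j| ≤ C / (1 + ‖y‖ ^ 2) ^ 2) :
    ∃ y, pfaffianSix (b y) = 0 := by
  by_contra! hne
  have hC0 : 0 ≤ C := by
    have := (abs_nonneg _).trans (hC 0 0 0)
    simpa using this
  have hdiv1 (y : EuclideanSpace ℝ (Fin 6)) : C / (1 + ‖y‖ ^ 2) ^ 2 ≤ C :=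
    div_le_self hC0 (one_le_pow₀ (le_add_of_nonneg_right (sq_nonneg _)))
  obtain ⟨α, hα, hdα, hαC⟩ := exists_primitive_of_closed hb hskew hcl
    fun y i j => (hC y i j).trans (hdiv1 y)
  have hcof (i j) : ContDiff ℝ 1 fun y => pfaffianCofactor (b y) i j := by
    simp only [pfaffianCofactor, pfaffianFour]
    fun_prop
  have hpf : Continuous fun y => pfaffianSix (b y) := by
    simp only [pfaffianSix]
    exact continuous_finsetSum _ fun j _ => (hb _ _).continuous.mul (hcof _ _).continuous
  -- A nowhere vanishing Pfaffian has constant sign `ε` by the intermediate value theorem.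
  obtain ⟨ε, hε1, hε⟩ : ∃ ε : ℝ, |ε| = 1 ∧ ∀ y, 0 < ε * pfaffianSix (b y) := by
    by_cases h : ∃ y, 0 < pfaffianSix (b y)
    · refine ⟨1, abs_one, fun y => ?_⟩
      by_contra! h0
      rw [one_mul] at h0
      obtain ⟨z, hz⟩ := mem_range_of_exists_le_of_exists_ge hpf ⟨y, h0⟩
        (h.imp fun _ hy => hy.le)
      exact hne z hz
    · push Not at h
      exact ⟨-1, by simp, fun y => by
        have := lt_of_le_of_ne (h y) (hne y)
        linarith⟩
  set W : EuclideanSpace ℝ (Fin 6) → Fin 6 → ℝ := fun y i =>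
    ε * ∑ j : Fin 5, pfaffianCofactor (b y) i j * α y (i.succAbove j) with hW
  have hdb (k l y) : fderiv ℝ (fun y => b y k l) y = - fderiv ℝ (fun y => b y l k) y := by
    rw [show (fun y => b y k l) = fun y => -b y l k from funext fun y => hskew y k l,
      fderiv_fun_neg]
  have hdiv (y) : ∑ i, fderiv ℝ (fun y => W y i) y (EuclideanSpace.single i 1)
      = 3 * (ε * pfaffianSix (b y)) := by
    have h1 := sum_pfaffianCofactor (b y)
      (fun k i j => fderiv ℝ (fun y => b y i j) y (EuclideanSpace.single k 1))
      (fun k i j => by rw [hdb i j]; rfl) (fun i j k => hcl y i j k) (α y)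
      (fun i j => fderiv ℝ (fun y => α y j) y (EuclideanSpace.single i 1)) (hdα y)
    rw [mul_left_comm, ← h1, Finset.mul_sum]
    refine Finset.sum_congr rfl fun i _ => ?_
    have hd (k l) : DifferentiableAt ℝ (fun y => b y k l) y := (hb k l).differentiable one_ne_zero y
    have h2 (j : Fin 5) := (fderiv_pfaffianCofactor hd i j
      (EuclideanSpace.single i 1)).1.hasFDerivAt.mul
      ((hα (i.succAbove j)).differentiable one_ne_zero y).hasFDerivAt
    have h3 := (HasFDerivAt.fun_sum (u := Finset.univ) fun j _ => h2 j).const_mul ε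
    have h4 : fderiv ℝ (fun y => W y i) y = _ := h3.fderiv
    rw [h4]
    simp only [smul_apply, sum_apply,
      add_apply, smul_eq_mul]
    congr 1
    refine Finset.sum_congr rfl fun j _ => ?_
    rw [(fderiv_pfaffianCofactor hd i j (EuclideanSpace.single i 1)).2]
    ring
  -- The constant collects five summands, a cofactor at most `3 B²` with `B` the pointwise bound on
  -- `b`, and `|α| ≤ 6 C ‖y‖`. The decay required is `‖y‖⁶ ‖y‖ ≤ (1 + ‖y‖²)⁴`, which holds with a
  -- power to spare.
  refine not_forall_divergence_pos (W := W) (C := 5 * (3 * C ^ 2 * (6 * C))) (fun i => ?_)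
    (fun y i => ?_) fun y => ?_
  · exact contDiff_const.mul (ContDiff.sum fun j _ => (hcof i j).mul (hα _))
  · have h1 : |W y i| ≤ 5 * (3 * (C / (1 + ‖y‖ ^ 2) ^ 2) ^ 2 * (6 * C * ‖y‖)) := by
      rw [hW, abs_mul, hε1, one_mul]
      refine (Finset.abs_sum_le_sum_abs _ _).trans ((Finset.sum_le_card_nsmul _ _ _
        fun j _ => ?_).trans (by simp; rfl))
      rw [abs_mul]
      exact mul_le_mul (abs_pfaffianCofactor_le (hC y) i j) (by exact_mod_cast hαC y _)
        (abs_nonneg _) (by positivity)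
    have h2 : ‖y‖ ^ 7 ≤ (1 + ‖y‖ ^ 2) ^ 4 := by
      rcases le_total ‖y‖ 1 with h | h
      · exact (pow_le_one₀ (norm_nonneg _) h).trans
          (one_le_pow₀ (le_add_of_nonneg_right (sq_nonneg _)))
      · calc ‖y‖ ^ 7 ≤ ‖y‖ ^ 8 := pow_le_pow_right₀ h (by norm_num)
          _ = (‖y‖ ^ 2) ^ 4 := by ring
          _ ≤ _ := by gcongr; linarith
    calc ‖y‖ ^ 6 * |W y i|
        ≤ ‖y‖ ^ 6 * (5 * (3 * (C / (1 + ‖y‖ ^ 2) ^ 2) ^ 2 * (6 * C * ‖y‖))) := by gcongr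
      _ = 5 * (3 * C ^ 2 * (6 * C)) * (‖y‖ ^ 7 / (1 + ‖y‖ ^ 2) ^ 4) := by
        field_simp
      _ ≤ 5 * (3 * C ^ 2 * (6 * C)) * 1 := by
        gcongr
        exact (div_le_one (by positivity)).2 h2
      _ = _ := mul_one _
  · rw [hdiv]
    have := hε y
    positivity

/-! ### The symplectic form pulled back by a map to complex structures. -/

section ComplexStructureValued

variable {E : Type*} [NormedAddCommGroup E] [NormedSpace ℝ E]
  {𝔸 : Type*} [NormedRing 𝔸] [NormedAlgebra ℝ 𝔸]

/-- The two-form `τ (K dK dK)` attached to a map `K` to an algebra with trace `τ`. When `K² = -1` it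
is the pullback of the invariant symplectic form on the space of complex structures. -/
def traceForm (τ : 𝔸 →L[ℝ] ℝ) (K : E → 𝔸) (y u v : E) : ℝ :=
  τ (K y * fderiv ℝ K y u * fderiv ℝ K y v)

theorem mul_fderiv_eq_neg_of_mul_self {K : E → 𝔸} (hK : Differentiable ℝ K)
    (hsq : ∀ y, K y * K y = -1) (y v : E) :
    K y * fderiv ℝ K y v = -(fderiv ℝ K y v * K y) := by
  have h1 := (hK y).hasFDerivAt.mul' (hK y).hasFDerivAt
  have h2 : HasFDerivAt (K * K) (0 : E →L[ℝ] 𝔸) y := by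
    rw [show K * K = fun _ => -1 from funext hsq]
    exact hasFDerivAt_const _ _
  have h3 := DFunLike.congr_fun (h1.unique h2) v
  have h4 : K y * fderiv ℝ K y v + fderiv ℝ K y v * K y = 0 := by simpa using h3
  exact eq_neg_of_add_eq_zero_left h4

theorem traceForm_skew {τ : 𝔸 →L[ℝ] ℝ} (hτ : ∀ a b, τ (a * b) = τ (b * a)) {K : E → 𝔸}
    (hK : Differentiable ℝ K) (hsq : ∀ y, K y * K y = -1) (y u v : E) :
    traceForm τ K y u v = -traceForm τ K y v u := by
  rw [traceForm, traceForm, hτ, ← mul_assoc,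
    ← neg_eq_iff_eq_neg.2 (mul_fderiv_eq_neg_of_mul_self hK hsq y v), neg_mul, map_neg]

/-- Three factors that anticommute with `k` have a product that anticommutes with `k`, so
conjugation by `k` reverses its sign while preserving the trace. -/
theorem trace_mul_mul_eq_zero {τ : 𝔸 →L[ℝ] ℝ} (hτ : ∀ a b, τ (a * b) = τ (b * a)) {k a b c : 𝔸}
    (hk : k * k = -1) (ha : k * a = -(a * k)) (hb : k * b = -(b * k)) (hc : k * c = -(c * k)) :
    τ (a * b * c) = 0 := by
  have h1 : k * (a * b * c) = -(a * b * c * k) := by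
    calc k * (a * b * c) = k * a * b * c := by simp only [mul_assoc]
      _ = -(a * (k * b) * c) := by rw [ha]; simp only [mul_assoc, neg_mul]
      _ = a * b * (k * c) := by rw [hb]; simp only [mul_assoc, neg_mul, mul_neg, neg_neg]
      _ = _ := by rw [hc]; simp only [mul_assoc, mul_neg]
  have h2 : τ (k * (k * (a * b * c))) = - τ (a * b * c) := by
    rw [← mul_assoc, hk, neg_mul, one_mul, map_neg]
  have h3 : τ (k * (k * (a * b * c))) = τ (a * b * c) := by
    rw [h1, mul_neg, map_neg, hτ, mul_assoc, hk, mul_neg, mul_one, map_neg, neg_neg]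
  linarith

theorem contDiff_traceForm (τ : 𝔸 →L[ℝ] ℝ) {K : E → 𝔸} (hK : ContDiff ℝ 2 K) (u v : E) :
    ContDiff ℝ 1 fun y => traceForm τ K y u v := by
  have h (u : E) : ContDiff ℝ 1 fun y => fderiv ℝ K y u :=
    (hK.fderiv_right (by norm_num)).clm_apply contDiff_const
  exact τ.contDiff.comp (((hK.of_le (by norm_num)).mul (h u)).mul (h v))

theorem fderiv_traceForm (τ : 𝔸 →L[ℝ] ℝ) {K : E → 𝔸} (hK : ContDiff ℝ 2 K) (y u v w : E) :
    fderiv ℝ (fun y => traceForm τ K y u v) y w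
      = τ (fderiv ℝ K y w * fderiv ℝ K y u * fderiv ℝ K y v)
        + τ (K y * fderiv ℝ (fderiv ℝ K) y w u * fderiv ℝ K y v)
        + τ (K y * fderiv ℝ K y u * fderiv ℝ (fderiv ℝ K) y w v) := by
  have h0 := (hK.differentiable two_ne_zero y).hasFDerivAt
  have h1 : HasFDerivAt (fderiv ℝ K) (fderiv ℝ (fderiv ℝ K) y) y :=
    ((hK.fderiv_right (m := 1) (by norm_num)).differentiable one_ne_zero y).hasFDerivAt
  have h2 (u : E) := h1.clm_apply (hasFDerivAt_const u y)
  have h3 : HasFDerivAt (fun y => traceForm τ K y u v) _ y :=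
    τ.hasFDerivAt.comp y ((h0.mul' (h2 u)).mul' (h2 v))
  rw [h3.fderiv]
  simp [mul_assoc]
  ring

/-- The terms cubic in `dK` vanish by `trace_mul_mul_eq_zero`, because `dK` anticommutes with `K`.
The terms with second derivatives cancel in pairs by symmetry of the Hessian and cyclicity of the
trace. -/
theorem traceForm_closed {τ : 𝔸 →L[ℝ] ℝ} (hτ : ∀ a b, τ (a * b) = τ (b * a)) {K : E → 𝔸}
    (hK : ContDiff ℝ 2 K) (hsq : ∀ y, K y * K y = -1) (y u v w : E) :
    fderiv ℝ (fun y => traceForm τ K y v w) y u + fderiv ℝ (fun y => traceForm τ K y w u) y v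
      + fderiv ℝ (fun y => traceForm τ K y u v) y w = 0 := by
  have ha := mul_fderiv_eq_neg_of_mul_self (hK.differentiable two_ne_zero) hsq y
  have hs (u v) : fderiv ℝ (fderiv ℝ K) y u v = fderiv ℝ (fderiv ℝ K) y v u :=
    (hK.contDiffAt.isSymmSndFDerivAt (by simp)) u v
  have h0 (u v w : E) : τ (fderiv ℝ K y u * fderiv ℝ K y v * fderiv ℝ K y w) = 0 :=
    trace_mul_mul_eq_zero hτ (hsq y) (ha u) (ha v) (ha w)
  have hc (a : 𝔸) (v : E) : τ (K y * a * fderiv ℝ K y v) = -τ (K y * fderiv ℝ K y v * a) := by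
    rw [mul_assoc, hτ, mul_assoc, hτ, ← neg_eq_iff_eq_neg.2 (ha v), neg_mul, map_neg, mul_assoc]
  rw [fderiv_traceForm τ hK, fderiv_traceForm τ hK, fderiv_traceForm τ hK]
  rw [h0, h0, h0, hc _ w, hc _ u, hc _ v, hs u v, hs v w, hs w u]
  ring

end ComplexStructureValued

/-- There is no conformally decaying, immersive holomorphic map from `ℝ⁶` with some almost complex
structure to the complex structures in an algebra on which the trace is negative definite. -/
theorem false_of_holomorphic_complexStructure {𝔸 : Type*} [NormedRing 𝔸] [NormedAlgebra ℝ 𝔸]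
    {τ : 𝔸 →L[ℝ] ℝ} (hτ : ∀ a b, τ (a * b) = τ (b * a)) {K : EuclideanSpace ℝ (Fin 6) → 𝔸}
    (hK : ContDiff ℝ 2 K) (hsq : ∀ y, K y * K y = -1)
    (hneg : ∀ y v, v ≠ 0 → τ (fderiv ℝ K y v * fderiv ℝ K y v) < 0)
    (hhol : ∀ y v, ∃ w, fderiv ℝ K y w = K y * fderiv ℝ K y v)
    {C D : ℝ} (hC : ∀ y, ‖fderiv ℝ K y‖ ≤ C / (1 + ‖y‖ ^ 2)) (hD : ∀ y, ‖K y‖ ≤ D) : False := by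
  have hK1 := hK.differentiable two_ne_zero
  set b : EuclideanSpace ℝ (Fin 6) → Fin 6 → Fin 6 → ℝ := fun y i j =>
    traceForm τ K y (EuclideanSpace.single i 1) (EuclideanSpace.single j 1) with hb
  have hskew (y i j) : b y i j = -b y j i := traceForm_skew hτ hK1 hsq _ _ _
  obtain ⟨y, hy⟩ := exists_pfaffianSix_eq_zero (b := b) (C := ‖τ‖ * (D * C * C))
    (fun i j => contDiff_traceForm τ hK _ _) hskew
    (fun y i j k => traceForm_closed hτ hK hsq _ _ _ _) fun y i j => by
      have h1 (i : Fin 6) : ‖fderiv ℝ K y (EuclideanSpace.single i 1)‖ ≤ C / (1 + ‖y‖ ^ 2) := by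
        refine (ContinuousLinearMap.le_opNorm _ _).trans ?_
        simpa using hC y
      have hD0 := (norm_nonneg _).trans (hD 0)
      have hC0 := (norm_nonneg _).trans (h1 0)
      rw [← Real.norm_eq_abs]
      calc ‖b y i j‖ ≤ ‖τ‖ * (D * (C / (1 + ‖y‖ ^ 2)) * (C / (1 + ‖y‖ ^ 2))) := by
            refine (τ.le_opNorm _).trans ?_
            gcongr
            refine (norm_mul_le _ _).trans ?_
            refine mul_le_mul ?_ (h1 j) (norm_nonneg _) (by positivity)
            exact (norm_mul_le _ _).trans (mul_le_mul (hD y) (h1 i) (norm_nonneg _) hD0)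
        _ = _ := by field_simp
  have hdet := det_eq_pfaffianSix_sq (b y) (hskew y)
  rw [hy, sq, mul_zero] at hdet
  obtain ⟨v, hv0, hv⟩ := Matrix.exists_mulVec_eq_zero_iff.2 hdet
  set x : EuclideanSpace ℝ (Fin 6) := WithLp.toLp 2 v with hx
  have hsum (u : EuclideanSpace ℝ (Fin 6)) : fderiv ℝ K y u
      = ∑ i, u i • fderiv ℝ K y (EuclideanSpace.single i 1) := by
    conv_lhs => rw [← (EuclideanSpace.basisFun (Fin 6) ℝ).sum_repr u]
    simp only [map_sum, map_smul, EuclideanSpace.basisFun_repr, EuclideanSpace.basisFun_apply]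
  have h1 (i : Fin 6) : τ (K y * fderiv ℝ K y (EuclideanSpace.single i 1) * fderiv ℝ K y x) = 0 := by
    rw [hsum x, Finset.mul_sum, map_sum]
    simp only [mul_smul_comm, map_smul, smul_eq_mul]
    have := congrFun hv i
    simp only [Matrix.mulVec, dotProduct, Matrix.of_apply, Pi.zero_apply] at this
    rw [← this]
    exact Finset.sum_congr rfl fun j _ => mul_comm _ _
  -- Since `x` is in the kernel of the form, pairing it with `w`, the direction of `K dK x`, gives
  -- zero. But this pairing is `τ (K² dK x dK x) = -τ (dK x dK x) > 0`.
  obtain ⟨w, hw⟩ := hhol y x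
  have h2 : τ (K y * fderiv ℝ K y w * fderiv ℝ K y x) = 0 := by
    rw [hsum w, Finset.mul_sum, Finset.sum_mul, map_sum]
    refine Finset.sum_eq_zero fun i _ => ?_
    rw [mul_smul_comm, smul_mul_assoc, map_smul, h1, smul_zero]
  rw [hw, ← mul_assoc, hsq, neg_mul, one_mul, neg_mul, map_neg] at h2
  have h3 := hneg y x fun h => hv0 (by simpa [hx] using congrArg WithLp.ofLp h)
  linarith

/-! ### Stereographic coordinates on the sphere. -/

/-- The inverse stereographic projection, as a conformal parametrization of the unit sphere with
explicit conformal factor. -/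
theorem exists_conformal_parametrization (n : ℕ) :
    ∃ p : EuclideanSpace ℝ (Fin n) → EuclideanSpace ℝ (Fin (n + 1)), ContDiff ℝ ∞ p ∧
      (∀ y, ‖p y‖ = 1) ∧ (∀ y h, ‖fderiv ℝ p y h‖ = 4 / (‖y‖ ^ 2 + 4) * ‖h‖) ∧
      ∀ y X, inner ℝ (p y) X = 0 → ∃ h, fderiv ℝ p y h = X := by
  set v : EuclideanSpace ℝ (Fin (n + 1)) := EuclideanSpace.single 0 1
  have hv : ‖v‖ = 1 := by simp [v]
  have hv0 : v ≠ 0 := norm_ne_zero_iff.1 (by rw [hv]; exact one_ne_zero)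
  have := Fact.mk (@finrank_euclideanSpace_fin ℝ _ (n + 1))
  let L : EuclideanSpace ℝ (Fin n) →ₗᵢ[ℝ] EuclideanSpace ℝ (Fin (n + 1)) :=
    (ℝ ∙ v)ᗮ.subtypeₗᵢ.comp
      (OrthonormalBasis.fromOrthogonalSpanSingleton n hv0).repr.symm.toLinearIsometry
  have hL (y) : inner ℝ v (L y) = 0 := Submodule.mem_orthogonal_singleton_iff_inner_right.1
    ((OrthonormalBasis.fromOrthogonalSpanSingleton n hv0).repr.symm y).2
  set p : EuclideanSpace ℝ (Fin n) → EuclideanSpace ℝ (Fin (n + 1)) :=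
    fun y => stereoInvFunAux v (L y) with hp
  have hsm : ContDiff ℝ ∞ p := contDiff_stereoInvFunAux.comp L.contDiff
  have hnorm (y) : ‖p y‖ = 1 := mem_sphere_zero_iff_norm.1
    (stereoInvFunAux_mem hv (Submodule.mem_orthogonal_singleton_iff_inner_right.2 (hL y)))
  have hder (y h) : fderiv ℝ p y h = (4 / (‖y‖ ^ 2 + 4)) • L h
      + (8 * inner ℝ y h / (‖y‖ ^ 2 + 4) ^ 2) • ((2 : ℝ) • v - L y) := by
    have hs : ‖y‖ ^ 2 + 4 ≠ 0 := by positivity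
    have h1 : HasFDerivAt (fun y : EuclideanSpace ℝ (Fin n) => ‖y‖ ^ 2) _ y :=
      (hasStrictFDerivAt_norm_sq y).hasFDerivAt
    have h2 : HasFDerivAt (fun y : EuclideanSpace ℝ (Fin n) => (‖y‖ ^ 2 + 4)⁻¹) _ y :=
      (hasDerivAt_inv hs).comp_hasFDerivAt y (h1.add_const 4)
    have h3 : HasFDerivAt (fun y => (4 : ℝ) • L y) _ y := (L.toContinuousLinearMap.hasFDerivAt (x := y)).const_smul (4 : ℝ)
    have h4 : HasFDerivAt (fun y => (‖y‖ ^ 2 - 4) • v) _ y := (h1.sub_const 4).smul_const v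
    have h5 : p = fun y => (‖y‖ ^ 2 + 4)⁻¹ • ((4 : ℝ) • L y + (‖y‖ ^ 2 - 4) • v) :=
      funext fun z => by simp only [hp, stereoInvFunAux_apply, L.norm_map]
    have h6 : HasFDerivAt (fun y => (‖y‖ ^ 2 + 4)⁻¹ • ((4 : ℝ) • L y + (‖y‖ ^ 2 - 4) • v)) _ y :=
      h2.fun_smul (h3.fun_add h4)
    rw [h5, h6.fderiv]
    simp only [add_apply, smul_apply, ContinuousLinearMap.smulRight_apply, innerSL_apply_apply,
      LinearIsometry.coe_toContinuousLinearMap]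
    match_scalars <;> simp <;> field_simp <;> ring
  -- Conformality: since `‖2v - L y‖² = ‖y‖² + 4`, the square of the second term of the derivative
  -- cancels the cross term.
  have hnd (y h) : ‖fderiv ℝ p y h‖ = 4 / (‖y‖ ^ 2 + 4) * ‖h‖ := by
    have hs : ‖y‖ ^ 2 + 4 ≠ 0 := by positivity
    rw [← sq_eq_sq₀ (norm_nonneg _) (by positivity), hder, ← real_inner_self_eq_norm_sq]
    simp only [inner_add_left, inner_add_right, inner_smul_left, inner_smul_right, inner_sub_left,
      inner_sub_right, hL, real_inner_comm v, LinearIsometry.inner_map_map,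
      real_inner_self_eq_norm_sq, hv, real_inner_comm h y]
    simp
    field_simp
    ring
  refine ⟨p, hsm, hnorm, hnd, fun y X hX => ?_⟩
  have hinj : Function.Injective (fderiv ℝ p y).toLinearMap := by
    rw [← LinearMap.ker_eq_bot, LinearMap.ker_eq_bot']
    intro h h0
    have h1 := hnd y h
    rw [show fderiv ℝ p y h = 0 from h0, norm_zero, eq_comm, mul_eq_zero] at h1
    exact norm_eq_zero.1 (h1.resolve_left (by positivity))
  have hle : (fderiv ℝ p y).toLinearMap.range ≤ (ℝ ∙ p y)ᗮ := by
    rintro _ ⟨h, rfl⟩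
    rw [Submodule.mem_orthogonal_singleton_iff_inner_right]
    have h1 : HasFDerivAt p (fderiv ℝ p y) y :=
      (hsm.differentiable (by simp) y).hasFDerivAt
    have h2 := h1.norm_sq
    have h3 : (fun y => ‖p y‖ ^ 2) = fun _ => 1 := funext fun y => by rw [hnorm, one_pow]
    rw [h3] at h2
    have h4 := DFunLike.congr_fun (h2.unique (hasFDerivAt_const _ _)) h
    simpa using h4
  have hp0 : p y ≠ 0 := norm_ne_zero_iff.1 (by rw [hnorm]; exact one_ne_zero)
  -- The injective differential has image in the tangent space `(p y)ᗮ`, of the same dimension,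
  -- hence fills it.
  have heq := Submodule.eq_of_le_of_finrank_eq hle (by
    rw [LinearMap.finrank_range_of_inj hinj, finrank_euclideanSpace_fin,
      Submodule.finrank_orthogonal_span_singleton (n := n) hp0])
  have hm : X ∈ (ℝ ∙ p y)ᗮ := Submodule.mem_orthogonal_singleton_iff_inner_right.2 hX
  rw [← heq] at hm
  exact hm

/-! ### Complex structures on `ℝ ⊕ F` built from a unit vector and an endomorphism of `F`. -/

section Suspension

variable {F : Type*} [NormedAddCommGroup F] [InnerProductSpace ℝ F] [FiniteDimensional ℝ F]

/-- The endomorphism `(s, w) ↦ (-⟪x, w⟫, s x + j w)` of `ℝ ⊕ F`, depending linearly on `(x, j)`. -/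
def suspension : F × (F →L[ℝ] F) →L[ℝ] WithLp 2 (ℝ × F) →L[ℝ] WithLp 2 (ℝ × F) :=
  LinearMap.toContinuousLinearMap
    { toFun := fun q => (WithLp.prodContinuousLinearEquiv 2 ℝ ℝ F).symm.toContinuousLinearMap ∘L
        ((-(innerSL ℝ q.1) ∘L ContinuousLinearMap.snd ℝ ℝ F).prod
          ((ContinuousLinearMap.toSpanSingleton ℝ q.1) ∘L ContinuousLinearMap.fst ℝ ℝ F
            + q.2 ∘L ContinuousLinearMap.snd ℝ ℝ F)) ∘L
        (WithLp.prodContinuousLinearEquiv 2 ℝ ℝ F).toContinuousLinearMap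
      map_add' := fun q r => by
        refine ContinuousLinearMap.ext fun x => WithLp.ofLp_injective 2 (Prod.ext ?_ ?_)
        · simp [add_comm]
        · simp; abel
      map_smul' := fun c q => by
        refine ContinuousLinearMap.ext fun x => WithLp.ofLp_injective 2 (Prod.ext ?_ ?_)
        · simp
        · simp [smul_comm c] }

theorem suspension_apply (x : F) (j : F →L[ℝ] F) (a : WithLp 2 (ℝ × F)) :
    suspension (x, j) a = WithLp.toLp 2 (-inner ℝ x a.snd, a.fst • x + j a.snd) := by
  simp [suspension]

theorem inner_suspension {x : F} {j : F →L[ℝ] F} (hj : ∀ u w, inner ℝ (j u) w = -inner ℝ u (j w))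
    (a b : WithLp 2 (ℝ × F)) :
    inner ℝ (suspension (x, j) a) b = -inner ℝ a (suspension (x, j) b) := by
  rw [suspension_apply, suspension_apply, WithLp.prod_inner_apply, WithLp.prod_inner_apply]
  simp [inner_add_left, inner_add_right, inner_smul_left, inner_smul_right, hj, real_inner_comm x]
  ring

variable (F) in
/-- The trace of endomorphisms of `ℝ ⊕ F`. -/
def traceSuspension : (WithLp 2 (ℝ × F) →L[ℝ] WithLp 2 (ℝ × F)) →L[ℝ] ℝ :=
  LinearMap.toContinuousLinearMap
    ((LinearMap.trace ℝ (WithLp 2 (ℝ × F))) ∘ₗ ContinuousLinearMap.coeLM ℝ)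

theorem traceSuspension_mul_comm (a b : WithLp 2 (ℝ × F) →L[ℝ] WithLp 2 (ℝ × F)) :
    traceSuspension F (a * b) = traceSuspension F (b * a) :=
  LinearMap.trace_mul_comm ℝ a.toLinearMap b.toLinearMap

/-- For a skew endomorphism the trace of the square is minus the sum of squared norms over an
orthonormal basis. The endomorphism is nonzero because it sends `(1, 0)` to `(0, x)`. -/
theorem traceSuspension_mul_self_neg {x : F} {j : F →L[ℝ] F}
    (hj : ∀ u w, inner ℝ (j u) w = -inner ℝ u (j w)) (hx : x ≠ 0) :
    traceSuspension F (suspension (x, j) * suspension (x, j)) < 0 := by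
  set M := suspension (x, j)
  let e := stdOrthonormalBasis ℝ (WithLp 2 (ℝ × F))
  have h1 : traceSuspension F (M * M) = -∑ i, ‖M (e i)‖ ^ 2 := by
    rw [show traceSuspension F (M * M) = LinearMap.trace ℝ _ (M * M).toLinearMap from rfl,
      LinearMap.trace_eq_sum_inner _ e, ← Finset.sum_neg_distrib]
    refine Finset.sum_congr rfl fun i _ => ?_
    rw [← real_inner_self_eq_norm_sq, inner_suspension hj, neg_neg]
    rfl
  rw [h1, neg_lt_zero]
  by_contra! h
  have h2 := (Finset.sum_eq_zero_iff_of_nonneg fun i _ => sq_nonneg _).1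
    (le_antisymm h (Finset.sum_nonneg fun i _ => sq_nonneg _))
  have h3 : M.toLinearMap = 0 := e.toBasis.ext fun i => by
    have := h2 i (Finset.mem_univ _)
    simpa using this
  have h4 := congrArg WithLp.snd (DFunLike.congr_fun h3 (WithLp.toLp 2 ((1 : ℝ), (0 : F))))
  rw [ContinuousLinearMap.coe_coe, suspension_apply] at h4
  exact hx (by simpa using h4)

end Suspension

section

variable {F : Type*} [NormedAddCommGroup F] [InnerProductSpace ℝ F] [FiniteDimensional ℝ F]

/-- This is the holomorphy of `K`. It is applied with `X` tangent at `x`, `X' = j X`, and `m`, `m'`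
the derivatives of `j` along `X` and `X'`; then `hm` comes from differentiating `j x = 0`, and `hm'`
is the integrability equation. -/
theorem suspension_mul {x X X' : F} {j m m' : F →L[ℝ] F} (h0 : inner ℝ x X = 0) (hX : j X = X')
    (hm : ∀ u, inner ℝ x (m u) = inner ℝ X' u) (hm' : ∀ u, m' u - j (m u) = -inner ℝ X u • x) :
    suspension (x, j) * suspension (X, m) = suspension (X', m') := by
  refine ContinuousLinearMap.ext fun a => WithLp.ofLp_injective 2 (Prod.ext ?_ ?_)
  · rw [mul_apply_eq_comp, suspension_apply, suspension_apply, suspension_apply]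
    simp [inner_add_right, inner_smul_right, hm, h0]
  · rw [mul_apply_eq_comp, suspension_apply, suspension_apply, suspension_apply]
    change -inner ℝ X a.snd • x + j (a.fst • X + m a.snd) = a.fst • X' + m' a.snd
    rw [map_add, map_smul, hX, eq_add_of_sub_eq (hm' a.snd)]
    abel

theorem suspension_mul_self {x : F} {j : F →L[ℝ] F} (hx : ‖x‖ = 1) (h0 : j x = 0)
    (hj : ∀ u w, inner ℝ (j u) w = -inner ℝ u (j w)) (hsq : ∀ w, j (j w) = -w + inner ℝ x w • x) :
    suspension (x, j) * suspension (x, j) = -1 := by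
  refine ContinuousLinearMap.ext fun a => WithLp.ofLp_injective 2 (Prod.ext ?_ ?_)
  · rw [mul_apply_eq_comp, suspension_apply, suspension_apply]
    have h1 : inner ℝ x (j a.snd) = 0 := by
      rw [← neg_eq_zero, ← hj, h0, inner_zero_left]
    simp [inner_add_right, inner_smul_right, h1, hx]
  · rw [mul_apply_eq_comp, suspension_apply, suspension_apply]
    simp [h0, hsq]

instance : NormedAddCommGroup (WithLp 2 (ℝ × F) →L[ℝ] WithLp 2 (ℝ × F)) :=
  ContinuousLinearMap.toNormedAddCommGroup

instance : SeminormedAddCommGroup (WithLp 2 (ℝ × F) →L[ℝ] WithLp 2 (ℝ × F)) :=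
  ContinuousLinearMap.toSeminormedAddCommGroup

variable (F) in
theorem exists_norm_suspension_le : ∃ B : ℝ, 0 < B ∧
    ∀ (x : F) (j : F →L[ℝ] F), ‖suspension (x, j)‖ ≤ B * max ‖x‖ ‖j‖ := by
  obtain ⟨B, hB0, hB⟩ := ContinuousLinearMap.bound (𝕜 := ℝ) (𝕜₂ := ℝ) (E := F × (F →L[ℝ] F))
    (F := WithLp 2 (ℝ × F) →L[ℝ] WithLp 2 (ℝ × F)) (suspension (F := F))
  exact ⟨B, hB0, fun x j => hB (x, j)⟩

theorem exists_bound_fderiv_of_isCompact {G H : Type*} [NormedAddCommGroup G] [NormedSpace ℝ G]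
    [NormedAddCommGroup H] [NormedSpace ℝ H] {f : G → H} {s : Set G} (hs : IsCompact s)
    (hf : ∀ x ∈ s, ContDiffAt ℝ 1 f x) : ∃ M, ∀ x ∈ s, ‖f x‖ ≤ M ∧ ‖fderiv ℝ f x‖ ≤ M := by
  obtain ⟨M₀, hM₀⟩ := hs.exists_bound_of_continuousOn (f := f) fun x hx =>
    (hf x hx).continuousAt.continuousWithinAt
  obtain ⟨M₁, hM₁⟩ := hs.exists_bound_of_continuousOn (f := fderiv ℝ f) fun x hx =>
    ((hf x hx).fderiv_right (m := 0) (by simp)).continuousAt.continuousWithinAt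
  exact ⟨max M₀ M₁, fun x hx => ⟨(hM₀ x hx).trans (le_max_left _ _),
    (hM₁ x hx).trans (le_max_right _ _)⟩⟩

end

/-! ### Nonexistence for structures given as fields of endomorphisms of `ℝ⁷`. -/

/-- There is no field of endomorphisms of `ℝ⁷` along the unit sphere which is skew, squares to minus
the tangential projection, and satisfies the integrability equation. -/
theorem false_of_ambient_complexStructure
    {J : EuclideanSpace ℝ (Fin 7) → EuclideanSpace ℝ (Fin 7) →L[ℝ] EuclideanSpace ℝ (Fin 7)}
    (hJ : ∀ x, ‖x‖ = 1 → ContDiffAt ℝ ∞ J x)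
    (hskew : ∀ x, ‖x‖ = 1 → ∀ u w, inner ℝ (J x u) w = -inner ℝ u (J x w))
    (hsq : ∀ x, ‖x‖ = 1 → ∀ w, J x (J x w) = -w + inner ℝ x w • x)
    (hint : ∀ x, ‖x‖ = 1 → ∀ X, inner ℝ x X = 0 → ∀ w,
      fderiv ℝ J x (J x X) w - J x (fderiv ℝ J x X w) = -inner ℝ X w • x) : False := by
  obtain ⟨p, hp, hnorm, hdp, hsurj⟩ := exists_conformal_parametrization 6
  have hJ0 (x) (hx : ‖x‖ = 1) : J x x = 0 := by
    have h1 := hskew x hx x (J x x)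
    rw [hsq x hx, real_inner_self_eq_norm_sq x, hx] at h1
    simpa using h1
  set j := fun y => J (p y) with hj
  have hjs : ContDiff ℝ ∞ j := contDiff_iff_contDiffAt.2 fun y =>
    (hJ (p y) (hnorm y)).comp y hp.contDiffAt
  have hpd (y) : HasFDerivAt p (fderiv ℝ p y) y := (hp.differentiable (by simp) y).hasFDerivAt
  have hjd (y) : HasFDerivAt j (fderiv ℝ j y) y := (hjs.differentiable (by simp) y).hasFDerivAt
  have hdj (y v) : fderiv ℝ j y v = fderiv ℝ J (p y) (fderiv ℝ p y v) := by
    have h1 := ((hJ (p y) (hnorm y)).differentiableAt (by simp)).hasFDerivAt.comp y (hpd y)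
    rw [show fderiv ℝ j y = _ from h1.fderiv]
    rfl
  have htan (y v) : inner ℝ (p y) (fderiv ℝ p y v) = 0 := by
    have h1 := (hpd y).norm_sq
    rw [show (fun y => ‖p y‖ ^ 2) = fun _ => 1 from funext fun y => by rw [hnorm, one_pow]] at h1
    have h2 := DFunLike.congr_fun (h1.unique (hasFDerivAt_const _ _)) v
    simpa using h2
  have hdskew (y v) (u w) : inner ℝ (fderiv ℝ j y v u) w = -inner ℝ u (fderiv ℝ j y v w) := by
    have h1 (u) := (hjd y).clm_apply (hasFDerivAt_const u y)
    have h2 := ((h1 u).inner ℝ (hasFDerivAt_const w y)).add ((hasFDerivAt_const u y).inner ℝ (h1 w))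
    have h3 : ((fun y => inner ℝ (j y u) w) + fun y => inner ℝ u (j y w)) = fun _ => (0 : ℝ) :=
      funext fun y => by simp [hj, hskew (p y) (hnorm y)]
    rw [h3] at h2
    have h4 := DFunLike.congr_fun (h2.unique (hasFDerivAt_const _ _)) v
    refine eq_neg_of_add_eq_zero_left ?_
    simpa using h4
  have hdj0 (y v) : fderiv ℝ j y v (p y) = -j y (fderiv ℝ p y v) := by
    have h1 := (hjd y).clm_apply (hpd y)
    rw [show (fun y => j y (p y)) = fun _ => 0 from funext fun y => hJ0 _ (hnorm y)] at h1
    have h4 := DFunLike.congr_fun (h1.unique (hasFDerivAt_const _ _)) v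
    refine eq_neg_of_add_eq_zero_right ?_
    simpa using h4
  set K := fun y => suspension (p y, j y) with hK
  have hKs : ContDiff ℝ ∞ K := (suspension (F := EuclideanSpace ℝ (Fin 7))).contDiff.comp (hp.prodMk hjs)
  have hdK (y v) : fderiv ℝ K y v = suspension (fderiv ℝ p y v, fderiv ℝ j y v) := by
    have h1 := suspension.hasFDerivAt.comp y ((hpd y).prodMk (hjd y))
    rw [show fderiv ℝ K y = _ from h1.fderiv]
    rfl
  obtain ⟨B, hB0, hB⟩ := exists_norm_suspension_le (EuclideanSpace ℝ (Fin 7))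
  have hcpt := isCompact_sphere (0 : EuclideanSpace ℝ (Fin 7)) 1
  obtain ⟨M, hM⟩ := exists_bound_fderiv_of_isCompact hcpt fun x hx =>
    (hJ x (mem_sphere_zero_iff_norm.1 hx)).of_le (by norm_cast)
  have hmem (y) : p y ∈ Metric.sphere (0 : EuclideanSpace ℝ (Fin 7)) 1 :=
    mem_sphere_zero_iff_norm.2 (hnorm y)
  -- `B` is the operator bound for `suspension` and `M` bounds `J` and its derivative on the compact
  -- sphere. The factor 4 comes from the conformal factor, at most `4 / (1 + ‖y‖²)`.
  refine false_of_holomorphic_complexStructure (τ := traceSuspension _) (K := K)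
    (C := B * (max 1 M * 4))
    (D := B * max 1 M)
    traceSuspension_mul_comm (hKs.of_le (by norm_cast)) (fun y => ?_)
    (fun y v hv => ?_) (fun y v => ?_) (fun y => ?_) (fun y => ?_)
  · exact suspension_mul_self (hnorm y) (hJ0 _ (hnorm y)) (hskew _ (hnorm y)) (hsq _ (hnorm y))
  · rw [hdK]
    refine traceSuspension_mul_self_neg (hdskew y v) fun h0 => hv ?_
    have h1 := hdp y v
    rw [h0, norm_zero, eq_comm, mul_eq_zero] at h1
    exact norm_eq_zero.1 (h1.resolve_left (by positivity))
  -- The direction `w` represents `J` applied to the tangent vector of `v`, which is again tangent.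
  · obtain ⟨w, hw⟩ := hsurj y (j y (fderiv ℝ p y v)) (by
      rw [← neg_eq_zero, ← hskew _ (hnorm y), hJ0 _ (hnorm y), inner_zero_left])
    refine ⟨w, ?_⟩
    rw [hdK, hdK]
    refine (suspension_mul (htan y v) hw.symm (fun u => ?_) fun u => ?_).symm
    · rw [← neg_eq_iff_eq_neg.2 (hdskew y v (p y) u), hdj0, inner_neg_left, neg_neg, hw]
    · rw [hdj, hdj, hw]
      exact hint (p y) (hnorm y) _ (htan y v) u
  · refine ContinuousLinearMap.opNorm_le_bound _ (by positivity) fun v => ?_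
    rw [hdK]
    refine (hB _ _).trans ?_
    rw [mul_div_assoc, mul_assoc]
    gcongr
    have h1 : ‖fderiv ℝ p y v‖ ≤ 4 / (1 + ‖y‖ ^ 2) * ‖v‖ := by
      rw [hdp]
      refine mul_le_mul_of_nonneg_right ?_ (norm_nonneg v)
      exact div_le_div_of_nonneg_left (by norm_num) (by positivity) (by linarith)
    have h2 : ‖fderiv ℝ j y v‖ ≤ M * ‖fderiv ℝ p y v‖ := by
      rw [hdj]
      exact (ContinuousLinearMap.le_opNorm _ _).trans (by gcongr; exact (hM _ (hmem y)).2)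
    rw [mul_div_assoc, mul_assoc]
    refine max_le ?_ ?_
    · exact (le_mul_of_one_le_left (norm_nonneg _) (le_max_left 1 M)).trans (by gcongr)
    · refine h2.trans ?_
      gcongr
      exact le_max_right _ _
  · refine (hB _ _).trans ?_
    refine mul_le_mul_of_nonneg_left ?_ hB0.le
    exact max_le ((hnorm y).le.trans (le_max_left _ _)) ((hM _ (hmem y)).1.trans (le_max_right _ _))

/-- The pointwise algebra of integrability: at a point `x` of the unit sphere, the symmetry of
`D(JX)Y - J(D X Y)` in `X`, `Y` given by the vanishing of the Nijenhuis tensor forces it to be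
normal to the sphere. -/
theorem integrability_of_symmetric {F : Type*} [NormedAddCommGroup F] [InnerProductSpace ℝ F]
    {x : F} (hx : ‖x‖ = 1) {J : F →L[ℝ] F} {D : F →L[ℝ] F →L[ℝ] F}
    (hJ : ∀ u w, inner ℝ (J u) w = -inner ℝ u (J w))
    (hsq : ∀ w, J (J w) = -w + inner ℝ x w • x)
    (hD : ∀ X u w, inner ℝ (D X u) w = -inner ℝ u (D X w))
    (hDx : ∀ X, inner ℝ x X = 0 → D X x = -J X)
    (hDsq : ∀ X, inner ℝ x X = 0 → ∀ w, D X (J w) + J (D X w) = inner ℝ X w • x + inner ℝ x w • X)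
    (hsym : ∀ X Y, inner ℝ x X = 0 → inner ℝ x Y = 0 →
      D (J X) Y - J (D X Y) = D (J Y) X - J (D Y X))
    (X : F) (hX : inner ℝ x X = 0) (w : F) :
    D (J X) w - J (D X w) = -inner ℝ X w • x := by
  have hxx : inner ℝ x x = 1 := by rw [real_inner_self_eq_norm_sq, hx, one_pow]
  have hJx : J x = 0 := by
    have h1 := hJ x (J x)
    rw [hsq, hxx] at h1
    simpa using h1
  have hJt (u) : inner ℝ x (J u) = 0 := by
    rw [← neg_eq_zero, ← hJ, hJx, inner_zero_left]
  have hskew (X Y Z : F) (hX : inner ℝ x X = 0) (hY : inner ℝ x Y = 0) (hZ : inner ℝ x Z = 0) :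
      inner ℝ (D (J X) Y - J (D X Y)) Z = -inner ℝ Y (D (J X) Z - J (D X Z)) := by
    have h1 := hDsq X hX Z
    rw [hZ, zero_smul, add_zero] at h1
    rw [inner_sub_left, inner_sub_right, hD, hJ, hD, eq_sub_of_add_eq h1, inner_sub_right,
      inner_smul_right, real_inner_comm x Y, hY]
    ring
  -- The trilinear expression is symmetric in its first two arguments and skew in its last two,
  -- hence zero, as in the uniqueness of the Levi-Civita connection.
  have hzero (X Y Z : F) (hX : inner ℝ x X = 0) (hY : inner ℝ x Y = 0) (hZ : inner ℝ x Z = 0) :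
      inner ℝ (D (J X) Y - J (D X Y)) Z = 0 := by
    have e1 := hskew X Y Z hX hY hZ
    have e2 := hskew Z X Y hZ hX hY
    have e3 := hskew Y Z X hY hZ hX
    rw [real_inner_comm _ Y] at e1
    rw [real_inner_comm _ X, hsym Z X hZ hX, hsym Z Y hZ hY] at e2
    rw [real_inner_comm _ Z, hsym Y X hY hX] at e3
    linarith
  have hT : ∀ w, inner ℝ x w = 0 → D (J X) w - J (D X w) = -inner ℝ X w • x := by
    intro w hw
    -- The normal component is forced by `D (J X) x = -J (J X) = X` and skewness of `D`.
    have hn : inner ℝ x (D (J X) w - J (D X w)) = -inner ℝ X w := by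
      rw [inner_sub_right, hJt, sub_zero, ← neg_eq_iff_eq_neg.2 (hD _ x w), hDx _ (hJt X), hsq, hX]
      simp
    refine ext_inner_right ℝ fun Z => ?_
    set c := inner ℝ x Z
    have hZ : inner ℝ x (Z - c • x) = 0 := by
      rw [inner_sub_right, inner_smul_right, hxx, mul_one, sub_self]
    have h1 := hzero X w _ hX hw hZ
    rw [inner_sub_right, inner_smul_right, real_inner_comm x, hn] at h1
    rw [real_inner_smul_left]
    linear_combination h1
  have hw : w = (w - inner ℝ x w • x) + inner ℝ x w • x := (sub_add_cancel _ _).symm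
  have h1 := hT (w - inner ℝ x w • x) (by
    rw [inner_sub_right, inner_smul_right, hxx, mul_one, sub_self])
  have h2 : D (J X) x - J (D X x) = 0 := by
    rw [hDx _ (hJt X), hDx _ hX, map_neg, sub_self]
  rw [inner_sub_right, inner_smul_right, real_inner_comm x X, hX, mul_zero, sub_zero] at h1
  rw [← h1]
  conv_lhs => rw [hw]
  rw [map_add, map_add, map_add, add_sub_add_comm, map_smul, map_smul, map_smul, ← smul_sub, h2,
    smul_zero, add_zero]

/-! ### Passing from tensors on the sphere to maps on the ambient space. -/

/-- The radial retraction `z ↦ z / ‖z‖` onto the unit sphere, with an arbitrary value at `0`. -/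
def radialRetraction (n : ℕ) (z : EuclideanSpace ℝ (Fin (n + 1))) : UnitSphere n :=
  if h : z = 0 then ⟨EuclideanSpace.single 0 1, by simp⟩
  else ⟨‖z‖⁻¹ • z, by simp [norm_smul, norm_ne_zero_iff.2 h]⟩

theorem coe_radialRetraction {n : ℕ} {z : EuclideanSpace ℝ (Fin (n + 1))} (hz : z ≠ 0) :
    sphereInclusion n (radialRetraction n z) = ‖z‖⁻¹ • z := by
  simp [radialRetraction, hz, sphereInclusion]

theorem sphereInclusion_ne_zero {n : ℕ} (x : UnitSphere n) : sphereInclusion n x ≠ 0 :=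
  ne_zero_of_mem_unit_sphere x

theorem norm_sphereInclusion {n : ℕ} (x : UnitSphere n) : ‖sphereInclusion n x‖ = 1 :=
  norm_eq_of_mem_sphere x

theorem radialRetraction_sphereInclusion {n : ℕ} (x : UnitSphere n) :
    radialRetraction n (sphereInclusion n x) = x := by
  refine Subtype.ext ?_
  change sphereInclusion n _ = sphereInclusion n x
  rw [coe_radialRetraction (sphereInclusion_ne_zero x), norm_sphereInclusion, inv_one, one_smul]

theorem contMDiffAt_radialRetraction {n : ℕ} {z : EuclideanSpace ℝ (Fin (n + 1))} (hz : z ≠ 0) :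
    ContMDiffAt 𝓘(ℝ, EuclideanSpace ℝ (Fin (n + 1))) (𝓡 n) ∞ (radialRetraction n) z := by
  have := Fact.mk (@finrank_euclideanSpace_fin ℝ _ (n + 1))
  let U : TopologicalSpace.Opens (EuclideanSpace ℝ (Fin (n + 1))) := ⟨{0}ᶜ, isOpen_compl_singleton⟩
  have hf : ContMDiff 𝓘(ℝ, EuclideanSpace ℝ (Fin (n + 1))) 𝓘(ℝ, EuclideanSpace ℝ (Fin (n + 1))) ∞
      (fun z : U => ‖(z : EuclideanSpace ℝ (Fin (n + 1)))‖⁻¹ • (z : EuclideanSpace ℝ (Fin (n + 1)))) := by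
    intro z
    have hz : (z : EuclideanSpace ℝ (Fin (n + 1))) ≠ 0 := z.2
    refine contMDiffAt_subtype_iff (f := fun z : EuclideanSpace ℝ (Fin (n + 1)) => ‖z‖⁻¹ • z).2 ?_
    exact (((contDiffAt_norm ℝ hz).inv (norm_ne_zero_iff.2 hz)).smul contDiffAt_id).contMDiffAt
  have h1 := hf.codRestrict_sphere (n := n) fun z => by
    have hz : (z : EuclideanSpace ℝ (Fin (n + 1))) ≠ 0 := z.2
    simp [norm_smul, norm_ne_zero_iff.2 hz]
  refine contMDiffAt_subtype_iff (U := U) (x := ⟨z, hz⟩).1 ?_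
  refine (h1 ⟨z, hz⟩).congr_of_eventuallyEq (.of_forall fun w => Subtype.ext ?_)
  exact coe_radialRetraction w.2

theorem hasFDerivAt_radialRetraction {n : ℕ} (x : UnitSphere n) :
    HasFDerivAt (fun z => sphereInclusion n (radialRetraction n z))
      (ContinuousLinearMap.id ℝ (EuclideanSpace ℝ (Fin (n + 1)))
        - (innerSL ℝ (sphereInclusion n x)).smulRight (sphereInclusion n x))
      (sphereInclusion n x) := by
  set y := sphereInclusion n x with hy
  have hy0 : y ≠ 0 := sphereInclusion_ne_zero x
  have hy1 : ‖y‖ = 1 := norm_sphereInclusion x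
  have h0 : HasFDerivAt (fun z : EuclideanSpace ℝ (Fin (n + 1)) => ‖z‖ ^ 2) _ y :=
    (hasStrictFDerivAt_norm_sq y).hasFDerivAt
  have h1 : HasFDerivAt (fun z : EuclideanSpace ℝ (Fin (n + 1)) => ‖z‖) (innerSL ℝ y) y := by
    have h2 := h0.sqrt (by simp [hy1])
    simp only [Real.sqrt_sq (norm_nonneg _), hy1] at h2
    refine h2.congr_fderiv ?_
    ext v
    simp
  have h2 : HasFDerivAt (fun z : EuclideanSpace ℝ (Fin (n + 1)) => ‖z‖⁻¹) _ y :=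
    (hasDerivAt_inv (norm_ne_zero_iff.2 hy0)).comp_hasFDerivAt y h1
  have h3 : HasFDerivAt (fun z : EuclideanSpace ℝ (Fin (n + 1)) => ‖z‖⁻¹ • z) _ y :=
    h2.fun_smul (hasFDerivAt_id y)
  refine (h3.congr_of_eventuallyEq ?_).congr_fderiv ?_
  · filter_upwards [isOpen_compl_singleton.mem_nhds hy0] with z hz
    exact coe_radialRetraction hz
  · ext v : 1
    simp [hy1, sub_eq_add_neg]

theorem mvfderiv_comp_sphereInclusion {n : ℕ} {G : Type*} [NormedAddCommGroup G] [NormedSpace ℝ G]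
    {f : EuclideanSpace ℝ (Fin (n + 1)) → G} {x : UnitSphere n}
    (hf : DifferentiableAt ℝ f (sphereInclusion n x)) (v : TangentSpace (𝓡 n) x) :
    mvfderiv (𝓡 n) (fun y => f (sphereInclusion n y)) x v
      = fderiv ℝ f (sphereInclusion n x) (inclusionDeriv n x v) := by
  have h1 := mfderiv_comp x hf.mdifferentiableAt
    ((contMDiff_sphereInclusion n).mdifferentiable (by simp) x)
  rw [mfderiv_eq_fderiv] at h1
  exact DFunLike.congr_fun h1 v

theorem contMDiff_ambientField {n : ℕ} {Y : ∀ x : UnitSphere n, TangentSpace (𝓡 n) x}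
    (hY : IsSmoothVectorField Y) :
    ContMDiff (𝓡 n) 𝓘(ℝ, EuclideanSpace ℝ (Fin (n + 1))) ∞ (ambientField n Y) := by
  have h1 := (contMDiff_sphereInclusion n).contMDiff_tangentMap (m := ∞) (by simp)
  have h2 := h1.comp hY
  have h3 := (contMDiff_snd_tangentBundle_modelSpace (EuclideanSpace ℝ (Fin (n + 1)))
    𝓘(ℝ, EuclideanSpace ℝ (Fin (n + 1))) (n := ∞)).comp h2
  exact h3

theorem inner_sphereInclusion_inclusionDeriv {n : ℕ} (x : UnitSphere n) (v : TangentSpace (𝓡 n) x) :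
    inner ℝ (sphereInclusion n x) (inclusionDeriv n x v) = 0 := by
  have h1 : inclusionDeriv n x v ∈ (inclusionDeriv n x).range := ⟨v, rfl⟩
  rw [inclusionDeriv_range] at h1
  exact Submodule.mem_orthogonal_singleton_iff_inner_right.1 h1

theorem exists_inclusionDeriv_eq {n : ℕ} {x : UnitSphere n} {w : EuclideanSpace ℝ (Fin (n + 1))}
    (hw : inner ℝ (sphereInclusion n x) w = 0) : ∃ v, inclusionDeriv n x v = w := by
  have h1 := Submodule.mem_orthogonal_singleton_iff_inner_right.2 hw
  rwa [sphereInclusion, ← inclusionDeriv_range] at h1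

theorem inclusionDeriv_tangentialProjection_eq (n : ℕ) (x : UnitSphere n)
    (w : EuclideanSpace ℝ (Fin (n + 1))) :
    inclusionDeriv n x (tangentialProjection n x w)
      = w - inner ℝ (sphereInclusion n x) w • sphereInclusion n x := by
  have hx : inner ℝ (sphereInclusion n x) (sphereInclusion n x) = (1 : ℝ) := by
    rw [real_inner_self_eq_norm_sq, norm_sphereInclusion, one_pow]
  obtain ⟨v, hv⟩ := exists_inclusionDeriv_eq (x := x)
    (w := w - inner ℝ (sphereInclusion n x) w • sphereInclusion n x) (by
      rw [inner_sub_right, inner_smul_right, hx, mul_one, sub_self])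
  rw [← hv]
  refine congrArg _ (inclusionDeriv_injective n x ?_)
  rw [← sub_eq_zero, ← map_sub, ← inner_self_eq_zero (𝕜 := ℝ), map_sub, inner_sub_left, ← map_sub,
    inner_inclusionDeriv_tangentialProjection, hv, inner_sub_left, real_inner_smul_left,
    inner_sphereInclusion_inclusionDeriv]
  simp

/-- The tangential projections of a constant vector form a smooth vector field. -/
theorem isSmoothVectorField_tangentialProjection (n : ℕ) (w : EuclideanSpace ℝ (Fin (n + 1))) :
    IsSmoothVectorField (fun x : UnitSphere n => tangentialProjection n x w) := by
  set s : Set (EuclideanSpace ℝ (Fin (n + 1))) := {0}ᶜ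
  have hs : IsOpen s := isOpen_compl_singleton
  have hr : ContMDiffOn 𝓘(ℝ, EuclideanSpace ℝ (Fin (n + 1))) (𝓡 n) ∞ (radialRetraction n) s :=
    fun z hz => (contMDiffAt_radialRetraction hz).contMDiffWithinAt
  -- The differential of the radial retraction at a point of the sphere is the tangential
  -- projection, so the field is the tangent map of the retraction applied to the constant field `w`
  -- along the inclusion.
  have h1 := hr.contMDiffOn_tangentMapWithin (m := ∞) (by simp) hs.uniqueMDiffOn
  have hc : ContMDiff 𝓘(ℝ, EuclideanSpace ℝ (Fin (n + 1)))
      (𝓘(ℝ, EuclideanSpace ℝ (Fin (n + 1)))).tangent ∞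
      (fun z => (⟨z, w⟩ : TangentBundle 𝓘(ℝ, EuclideanSpace ℝ (Fin (n + 1)))
        (EuclideanSpace ℝ (Fin (n + 1))))) :=
    contMDiff_vectorSpace_iff_contDiff.2 contDiff_const
  have h2 := h1.comp_contMDiff (hc.comp (contMDiff_sphereInclusion n))
    fun x => sphereInclusion_ne_zero x
  refine h2.congr fun x => ?_
  have hcast (q : UnitSphere n) (hq : q = x) (v : EuclideanSpace ℝ (Fin n))
      (hv : inclusionDeriv n q v = inclusionDeriv n x (tangentialProjection n x w)) :
      (⟨x, tangentialProjection n x w⟩ : TangentBundle (𝓡 n) (UnitSphere n)) = ⟨q, v⟩ := by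
    subst hq
    rw [inclusionDeriv_injective n q hv]
  refine hcast _ (radialRetraction_sphereInclusion x) _ ?_
  have hx0 := sphereInclusion_ne_zero x
  have h3 := mfderiv_comp (sphereInclusion n x)
    ((contMDiff_sphereInclusion n).mdifferentiable (by simp) (radialRetraction n (sphereInclusion n x)))
    ((contMDiffAt_radialRetraction hx0).mdifferentiableAt (by simp))
  have h4 : mfderivWithin 𝓘(ℝ, EuclideanSpace ℝ (Fin (n + 1))) (𝓡 n) (radialRetraction n) s
      (sphereInclusion n x) = mfderiv 𝓘(ℝ, EuclideanSpace ℝ (Fin (n + 1))) (𝓡 n)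
        (radialRetraction n) (sphereInclusion n x) := mfderivWithin_of_isOpen hs hx0
  rw [mfderiv_eq_fderiv, Function.comp_def, (hasFDerivAt_radialRetraction x).fderiv] at h3
  have h5 := DFunLike.congr_fun h3 w
  rw [inclusionDeriv_tangentialProjection_eq]
  refine Eq.trans ?_ (h5.symm.trans ?_)
  · exact congrArg (fun L => inclusionDeriv n _ (L w)) h4
  · rfl

section AmbientEndomorphism

variable {n : ℕ} (A : ∀ x : UnitSphere n, TangentSpace (𝓡 n) x →L[ℝ] TangentSpace (𝓡 n) x)

/-- A field of endomorphisms of the tangent spaces of the sphere, seen as a field of endomorphisms of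
the ambient space killing the normal direction and extended radially. -/
def ambientEnd (z : EuclideanSpace ℝ (Fin (n + 1))) :
    EuclideanSpace ℝ (Fin (n + 1)) →L[ℝ] EuclideanSpace ℝ (Fin (n + 1)) :=
  inclusionDeriv n (radialRetraction n z) ∘L A (radialRetraction n z) ∘L
    tangentialProjection n (radialRetraction n z)

theorem ambientEnd_apply (z w : EuclideanSpace ℝ (Fin (n + 1))) :
    ambientEnd A z w = ambientField n (applyEnd A fun x => tangentialProjection n x w)
      (radialRetraction n z) := rfl

theorem ambientEnd_sphereInclusion (x : UnitSphere n) (w : EuclideanSpace ℝ (Fin (n + 1))) :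
    ambientEnd A (sphereInclusion n x) w = inclusionDeriv n x (A x (tangentialProjection n x w)) := by
  rw [ambientEnd_apply, radialRetraction_sphereInclusion]
  rfl

theorem ambientEnd_inclusionDeriv (x : UnitSphere n) (v : TangentSpace (𝓡 n) x) :
    ambientEnd A (sphereInclusion n x) (inclusionDeriv n x v) = inclusionDeriv n x (A x v) := by
  rw [ambientEnd_sphereInclusion, tangentialProjection_inclusionDeriv]

variable {A}

theorem isSmoothVectorField_applyEnd (hA : IsAlmostComplexStructure A)
    {Y : ∀ x : UnitSphere n, TangentSpace (𝓡 n) x} (hY : IsSmoothVectorField Y) :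
    IsSmoothVectorField (applyEnd A Y) :=
  hA.smooth.clm_bundle_apply hY

theorem contDiffAt_ambientEnd (hA : IsAlmostComplexStructure A)
    {z : EuclideanSpace ℝ (Fin (n + 1))} (hz : z ≠ 0) : ContDiffAt ℝ ∞ (ambientEnd A) z := by
  have h : ContDiffOn ℝ ∞ (ambientEnd A) {0}ᶜ := contDiffOn_clm_apply.2 fun w z hz =>
    ((contMDiff_ambientField (isSmoothVectorField_applyEnd hA
      (isSmoothVectorField_tangentialProjection n w)) (radialRetraction n z)).comp z
      (contMDiffAt_radialRetraction hz)).contDiffAt.contDiffWithinAt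
  exact h.contDiffAt (isOpen_compl_singleton.mem_nhds hz)

/-- Orthogonality together with `A² = -1` makes `A` skew; the tangential projection is self-adjoint,
so skewness passes to the ambient space. -/
theorem inner_ambientEnd (hA : IsAlmostComplexStructure A) (horth : IsOrthogonalFor (roundMetric n) A)
    (z u w : EuclideanSpace ℝ (Fin (n + 1))) :
    inner ℝ (ambientEnd A z u) w = -inner ℝ u (ambientEnd A z w) := by
  set x := radialRetraction n z with hx
  have h1 := horth x (A x (tangentialProjection n x u)) (tangentialProjection n x w)
  have h2 := inner_inclusionDeriv_tangentialProjection n x w (A x (tangentialProjection n x u))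
  have h3 := inner_inclusionDeriv_tangentialProjection n x u (A x (tangentialProjection n x w))
  rw [hA.apply_apply, map_neg, LinearMap.neg_apply, roundMetric_apply, roundMetric_apply,
    h3, real_inner_comm (inclusionDeriv n x (tangentialProjection n x w)), h2,
    real_inner_comm _ w] at h1
  exact h1.symm

theorem ambientEnd_ambientEnd (hA : IsAlmostComplexStructure A)
    (z w : EuclideanSpace ℝ (Fin (n + 1))) :
    ambientEnd A z (ambientEnd A z w)
      = -w + inner ℝ (sphereInclusion n (radialRetraction n z)) w
        • sphereInclusion n (radialRetraction n z) := by
  set x := radialRetraction n z with hx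
  have h1 : ambientEnd A z (ambientEnd A z w) = inclusionDeriv n x
      (A x (tangentialProjection n x (inclusionDeriv n x (A x (tangentialProjection n x w))))) := rfl
  rw [h1, tangentialProjection_inclusionDeriv, hA.apply_apply, map_neg,
    inclusionDeriv_tangentialProjection_eq]
  abel

end AmbientEndomorphism

theorem IsSmoothVectorField.isDifferentiableFieldAt {n : ℕ}
    {Y : ∀ x : UnitSphere n, TangentSpace (𝓡 n) x} (hY : IsSmoothVectorField Y) (x : UnitSphere n) :
    IsDifferentiableFieldAt Y x :=
  hY.mdifferentiable (by simp) x

/-! ### The Nijenhuis tensor in ambient terms, and the conclusion. -/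

section Integrability

variable {n : ℕ} {A : ∀ x : UnitSphere n, TangentSpace (𝓡 n) x →L[ℝ] TangentSpace (𝓡 n) x}

theorem mvfderiv_ambientField_applyEnd (hA : IsAlmostComplexStructure A) (x : UnitSphere n)
    (w : EuclideanSpace ℝ (Fin (n + 1))) (v : TangentSpace (𝓡 n) x) :
    mvfderiv (𝓡 n) (ambientField n (applyEnd A fun x => tangentialProjection n x w)) x v
      = fderiv ℝ (ambientEnd A) (sphereInclusion n x) (inclusionDeriv n x v) w := by
  have hd := ((contDiffAt_ambientEnd hA (sphereInclusion_ne_zero x)).differentiableAt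
    (by simp)).hasFDerivAt.clm_apply (hasFDerivAt_const w _)
  have h1 : ambientField n (applyEnd A fun x => tangentialProjection n x w)
      = fun y => ambientEnd A (sphereInclusion n y) w :=
    funext fun y => (ambientEnd_sphereInclusion A y w).symm
  rw [h1]
  refine (mvfderiv_comp_sphereInclusion hd.differentiableAt v).trans ?_
  rw [hd.fderiv]
  simp

/-- Since `w` is tangent at `x`, differentiating `w - ⟪y, w⟫ y` leaves only a normal vector. Thus
these extensions are parallel at `x`. -/
theorem mvfderiv_ambientField_tangentialProjection (x : UnitSphere n)
    {w : EuclideanSpace ℝ (Fin (n + 1))} (hw : inner ℝ (sphereInclusion n x) w = 0)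
    (v : TangentSpace (𝓡 n) x) :
    mvfderiv (𝓡 n) (ambientField n fun x => tangentialProjection n x w) x v
      = -(inner ℝ (inclusionDeriv n x v) w • sphereInclusion n x) := by
  have hd : HasFDerivAt (fun z => w - (inner ℝ z w : ℝ) • z) _ (sphereInclusion n x) :=
    (hasFDerivAt_const w _).sub
      (((hasFDerivAt_id _).inner ℝ (hasFDerivAt_const w _)).smul (hasFDerivAt_id _))
  have h1 : ambientField n (fun x => tangentialProjection n x w)
      = fun y => (fun z => w - (inner ℝ z w : ℝ) • z) (sphereInclusion n y) :=
    funext fun y => inclusionDeriv_tangentialProjection_eq n y w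
  rw [h1]
  refine (mvfderiv_comp_sphereInclusion hd.differentiableAt v).trans ?_
  rw [hd.fderiv]
  simp [hw]

theorem fderiv_ambientEnd_symm (hA : IsAlmostComplexStructure A) (hint : IsIntegrable A)
    (x : UnitSphere n) {X Y : EuclideanSpace ℝ (Fin (n + 1))}
    (hX : inner ℝ (sphereInclusion n x) X = 0) (hY : inner ℝ (sphereInclusion n x) Y = 0)
    (hJx : ambientEnd A (sphereInclusion n x) (sphereInclusion n x) = 0) :
    fderiv ℝ (ambientEnd A) (sphereInclusion n x) (ambientEnd A (sphereInclusion n x) X) Y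
        - ambientEnd A (sphereInclusion n x) (fderiv ℝ (ambientEnd A) (sphereInclusion n x) X Y)
      = fderiv ℝ (ambientEnd A) (sphereInclusion n x) (ambientEnd A (sphereInclusion n x) Y) X
        - ambientEnd A (sphereInclusion n x) (fderiv ℝ (ambientEnd A) (sphereInclusion n x) Y X) := by
  set U : ∀ x : UnitSphere n, TangentSpace (𝓡 n) x := fun x => tangentialProjection n x X with hU
  set V : ∀ x : UnitSphere n, TangentSpace (𝓡 n) x := fun x => tangentialProjection n x Y with hV
  have sU : IsSmoothVectorField U := isSmoothVectorField_tangentialProjection n X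
  have sV : IsSmoothVectorField V := isSmoothVectorField_tangentialProjection n Y
  have dU := sU.isDifferentiableFieldAt x
  have dV := sV.isDifferentiableFieldAt x
  have dAU := (isSmoothVectorField_applyEnd hA sU).isDifferentiableFieldAt x
  have dAV := (isSmoothVectorField_applyEnd hA sV).isDifferentiableFieldAt x
  have iU : inclusionDeriv n x (U x) = X := by
    rw [hU, inclusionDeriv_tangentialProjection_eq, hX, zero_smul, sub_zero]
  have iV : inclusionDeriv n x (V x) = Y := by
    rw [hV, inclusionDeriv_tangentialProjection_eq, hY, zero_smul, sub_zero]
  have iAU : inclusionDeriv n x (applyEnd A U x) = ambientEnd A (sphereInclusion n x) X :=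
    (ambientEnd_sphereInclusion A x X).symm
  have iAV : inclusionDeriv n x (applyEnd A V x) = ambientEnd A (sphereInclusion n x) Y :=
    (ambientEnd_sphereInclusion A x Y).symm
  have h0 := congrArg (inclusionDeriv n x) (hint U V sU sV x)
  rw [nijenhuis, map_sub, map_sub, map_zero, ← ambientEnd_inclusionDeriv, map_add, map_add,
    inclusionDeriv_mlieBracket n x _ _ dAU dAV, inclusionDeriv_mlieBracket n x _ _ dAU dV,
    inclusionDeriv_mlieBracket n x _ _ dU dAV, inclusionDeriv_mlieBracket n x _ _ dU dV,
    mvfderiv_ambientField_applyEnd hA, mvfderiv_ambientField_applyEnd hA,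
    mvfderiv_ambientField_applyEnd hA, mvfderiv_ambientField_applyEnd hA,
    mvfderiv_ambientField_tangentialProjection x hY, mvfderiv_ambientField_tangentialProjection x hY,
    mvfderiv_ambientField_tangentialProjection x hX, mvfderiv_ambientField_tangentialProjection x hX,
    iU, iV, iAU, iAV, real_inner_comm X Y] at h0
  -- The bracket of `U` and `V` cancels at `x`, and the normal parts of the mixed brackets are
  -- killed by `J`; only derivatives of `J` survive.
  simp only [map_sub, map_neg, map_smul, hJx, smul_zero, sub_self, sub_zero, neg_zero, zero_sub] at h0
  rw [sub_eq_zero] at h0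
  rw [sub_eq_iff_eq_add] at h0 ⊢
  rw [h0]
  abel

end Integrability

/-- **LeBrun's theorem**: the round six-sphere carries no orthogonal complex structure.

The structure induces a holomorphic immersion of the sphere into the Hermitian symmetric space of
orthogonal complex structures on `ℝ⁸`. The pullback of the symplectic form is closed and
nondegenerate, which is impossible: in stereographic coordinates its cube is the divergence of a
vector field decaying fast enough for the divergence theorem on `ℝ⁶`. The argument is global, as it
must be: constant complex structures in stereographic coordinates exist on the punctured sphere. -/
theorem not_isIntegrable_of_isOrthogonalFor_roundMetric
    {A : ∀ x : UnitSphere 6, TangentSpace (𝓡 6) x →L[ℝ] TangentSpace (𝓡 6) x}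
    (hA : IsAlmostComplexStructure A) (horth : IsOrthogonalFor (roundMetric 6) A) :
    ¬ IsIntegrable A := by
  intro hint
  have hx0 (x : EuclideanSpace ℝ (Fin 7)) (hx : ‖x‖ = 1) : ∃ y : UnitSphere 6, sphereInclusion 6 y = x :=
    ⟨⟨x, mem_sphere_zero_iff_norm.2 hx⟩, rfl⟩
  have hskew (x : EuclideanSpace ℝ (Fin 7)) := inner_ambientEnd hA horth x
  have hsq (y : UnitSphere 6) (w) := ambientEnd_ambientEnd hA (sphereInclusion 6 y) w
  simp only [radialRetraction_sphereInclusion] at hsq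
  have hJx (z : EuclideanSpace ℝ (Fin 7)) : ambientEnd A z (sphereInclusion 6 (radialRetraction 6 z)) = 0 := by
    have h1 := hskew z (sphereInclusion 6 (radialRetraction 6 z)) (ambientEnd A z
      (sphereInclusion 6 (radialRetraction 6 z)))
    rw [ambientEnd_ambientEnd hA, real_inner_self_eq_norm_sq (sphereInclusion 6 _),
      norm_sphereInclusion] at h1
    simpa using h1
  refine false_of_ambient_complexStructure (J := ambientEnd A) (fun x hx => ?_)
    (fun x _ => hskew x) (fun x hx => ?_) fun x hx X hX w => ?_
  · exact contDiffAt_ambientEnd hA (norm_ne_zero_iff.1 (by rw [hx]; exact one_ne_zero))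
  · obtain ⟨y, rfl⟩ := hx0 x hx
    exact hsq y
  · obtain ⟨y, rfl⟩ := hx0 x hx
    have hJy := hJx (sphereInclusion 6 y)
    rw [radialRetraction_sphereInclusion] at hJy
    have hd := ((contDiffAt_ambientEnd hA (sphereInclusion_ne_zero y)).differentiableAt
      (by simp)).hasFDerivAt
    have hr := hasFDerivAt_radialRetraction y
    -- The derivative conditions come from differentiating skewness, `J r = 0` and `J² = -1 + ⟪r, ·⟫
    -- r`, where `r` is the radial retraction. In this form the identities hold off the sphere as
    -- well, so ordinary derivatives apply.
    refine integrability_of_symmetric hx (hskew _) (hsq y) (fun X u w => ?_) (fun X hX => ?_)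
      (fun X hX w => ?_) (fun X Y hX hY => fderiv_ambientEnd_symm hA hint y hX hY hJy)
      X hX w
    · have h1 (u) := hd.clm_apply (hasFDerivAt_const u (sphereInclusion 6 y))
      have h2 := ((h1 u).inner ℝ (hasFDerivAt_const w _)).add
        ((hasFDerivAt_const u _).inner ℝ (h1 w))
      have h3 : ((fun z => inner ℝ (ambientEnd A z u) w) + fun z => inner ℝ u (ambientEnd A z w))
          = fun _ => (0 : ℝ) := funext fun z => by simp [hskew]
      rw [h3] at h2
      have h4 := DFunLike.congr_fun (h2.unique (hasFDerivAt_const _ _)) X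
      refine eq_neg_of_add_eq_zero_left ?_
      simpa using h4
    · have h1 := hd.clm_apply hr
      rw [show (fun z => ambientEnd A z (sphereInclusion 6 (radialRetraction 6 z))) = fun _ => 0
        from funext hJx, radialRetraction_sphereInclusion] at h1
      have h4 := DFunLike.congr_fun (h1.unique (hasFDerivAt_const _ _)) X
      refine eq_neg_of_add_eq_zero_right ?_
      simpa [hX] using h4
    · have h1 := hd.clm_apply (hd.clm_apply (hasFDerivAt_const w (sphereInclusion 6 y)))
      have h2 := ((hr.inner ℝ (hasFDerivAt_const w _)).smul hr).const_add (-w)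
      rw [show (fun z => ambientEnd A z (ambientEnd A z w)) = _ from
        funext fun z => ambientEnd_ambientEnd hA z w] at h1
      have h4 := DFunLike.congr_fun (h1.unique h2) X
      rw [radialRetraction_sphereInclusion] at h4
      simpa [hX, add_comm] using h4

end

theorem mainTheorem4
    (A : ∀ x : UnitSphere 6, TangentSpace (𝓡 6) x →L[ℝ] TangentSpace (𝓡 6) x)
    (hA : IsAlmostComplexStructure A)
    (hint : IsIntegrable A)
    (horth : IsOrthogonalFor (roundMetric 6) A) :
    (∀ X : Fin 4 → ∀ x : UnitSphere 6, TangentSpace (𝓡 6) x, (∀ i, IsSmoothVectorField (X i)) →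
      ∀ x : UnitSphere 6,
        wedgeMetric (roundMetric 6) (extCovDerivForm (roundLeviCivita 6) A)
            (extCovDerivForm (roundLeviCivita 6) A) X x
          + 2 * wedgeReal (fundamentalTwoForm (roundMetric 6) A)
            (fundamentalTwoForm (roundMetric 6) A) X x = 0) ∧
    (∀ X Y : ∀ x : UnitSphere 6, TangentSpace (𝓡 6) x,
      IsSmoothVectorField X → IsSmoothVectorField Y → ∀ x : UnitSphere 6,
        metricNorm (roundMetric 6) x (covDerivEnd (roundLeviCivita 6) A X Y x) ^ 2
          = roundMetric 6 x (covDerivEnd (roundLeviCivita 6) A X X x)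
              (covDerivEnd (roundLeviCivita 6) A Y Y x)
            - (1 / 2 : ℝ) * (fundamentalForm (roundMetric 6) A x (X x) (Y x) ^ 2
              - metricNorm (roundMetric 6) x (X x) ^ 2 * metricNorm (roundMetric 6) x (Y x) ^ 2
              + roundMetric 6 x (X x) (Y x) ^ 2)) ∧
    (∀ X Y Z : ∀ x : UnitSphere 6, TangentSpace (𝓡 6) x,
      IsSmoothVectorField X → IsSmoothVectorField Y → IsSmoothVectorField Z →
        ∀ x : UnitSphere 6,
          roundMetric 6 x (extCovDeriv (roundLeviCivita 6) A X Y x)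
            (covDerivEnd (roundLeviCivita 6) A Z Z x) = 0) ∧
    (∀ X Y : ∀ x : UnitSphere 6, TangentSpace (𝓡 6) x,
      IsSmoothVectorField X → IsSmoothVectorField Y → ∀ x : UnitSphere 6,
        fundamentalForm (roundMetric 6) A x (covDerivEnd (roundLeviCivita 6) A X X x)
          (covDerivEnd (roundLeviCivita 6) A Y Y x) = 0) ∧
    (∀ X Y : ∀ x : UnitSphere 6, TangentSpace (𝓡 6) x,
      IsSmoothVectorField X → IsSmoothVectorField Y → ∀ x : UnitSphere 6,
        metricNorm (roundMetric 6) x (covDerivEnd (roundLeviCivita 6) A X Y x)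
          = metricNorm (roundMetric 6) x (covDerivEnd (roundLeviCivita 6) A Y X x)) := by
  exact absurd hint (not_isIntegrable_of_isOrthogonalFor_roundMetric hA horth)
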